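/- **Setting.** Let $n\in\{2,3\}$, let $\Omega\subset\mathbb R^n$ be a weakly Lipschitz polytopal domain whose boundary is split into two disjoint relatively open polytopal parts with $\partial\Omega=\overline{\Gamma_{\rm D}}\cup\overline{\Gamma_{\rm N}}$, and let $\mathcal T_h$ be a matching mesh of $\Omega$ into open simplices such that each boundary face lies either in $\Gamma_{\rm D}$ or in $\Gamma_{\rm N}$. Let $k>0$, and let $\underline{\boldsymbol A}:\Omega\to\mathbb C^{n\times n}$, $\boldsymbol b,\boldsymbol c:\Omega\to\mathbb C^n$, $d:\Omega\to\mathbb C$, $\mathfrak m,\mathfrak p:\Omega\to\mathbb R$ and $\mathfrak A:\Omega\to\mathbb R^{n\times n}$ be constant on each element, with $\mathfrak m>0$, $\mathfrak p\ge 0$, $\mathfrak p\not\equiv 0$, and $\mathfrak A$ symmetric positive definite. Write $(\cdot,\cdot)_\Omega$ for the complex $L^2(\Omega)$ inner product (antilinear in the second argument), $\|v\|_{w}^2=(wv,v)_\Omega$ for a scalar or matrix weight $w$, $\dagger$ for the complex conjugate of scalars and vectors and for the adjoint of matrices, and $H^1_{\Gamma_{\rm D}}(\Omega)$ for the functions of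 $H^1(\Omega)$ with vanishing trace on $\Gamma_{\rm D}$. For $u,v\in H^1_{\Gamma_{\rm D}}(\Omega)$ let $$\beta(u,v)=(-k^2du+ik\boldsymbol c\cdot\nabla u,v)_\Omega+(ik\boldsymbol b u+\underline{\boldsymbol A}\nabla u,\nabla v)_\Omega,\qquad |||u|||^2=k^2\|u\|_{\mathfrak m}^2+\|\nabla u\|_{\mathfrak A}^2,$$ and assume the Gårding inequality $\operatorname{Re}\beta(u,u)\ge |||u|||^2-2k^2\|u\|_{\mathfrak p}^2$ for all $u\in H^1_{\Gamma_{\rm D}}(\Omega)$. For $K\in\mathcal T_h$ let $h_K$ be the diameter of $K$, $p_K=\mathfrak p|_K$, $\alpha_K^\flat$ the smallest eigenvalue of $\mathfrak A|_K$, and $\vartheta_K=\sqrt{\alpha_K^\flat/p_K}$ (with $h_K/\vartheta_K=0$ if $p_K=0$). Let $K_\star$ maximize $h_K/\vartheta_K$ over $\mathcal T_h$, and put $\mathfrak h=h_{K_\star}$, $\mathfrak v=\vartheta_{K_\star}$. Let $r\ge1$ and $q\ge0$. Let $V_h$ be the space of the functions of $H^1_{\Gamma_{\rm D}}(\Omega)$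 that are polynomials of degree at most $r$ on each element, $Q_h$ the space of (discontinuous) piecewise polynomials of degree at most $q$, and $\pi_h$ the $L^2(\Omega)$-orthogonal projection onto $Q_h$. Assume that for each $\theta_h\in Q_h$ there is a unique $\mathscr P_h(\theta_h)\in V_h$ with $\beta(w_h,\mathscr P_h(\theta_h))=k^2(\mathfrak p w_h,\theta_h)_\Omega$ for all $w_h\in V_h$, and put $$\Theta_h=\max_{\theta_h\in Q_h,\ k\|\theta_h\|_{\mathfrak m}=1}|||\mathscr P_h(\theta_h)|||.$$ Let $\boldsymbol{\mathscr F}_h$ be any linear map from $Q_h$ into the space of $H(\operatorname{div},\Omega)$ fields with vanishing normal trace on $\Gamma_{\rm N}$ such that, for all $\theta_h\in Q_h$, $$\operatorname{div}\boldsymbol{\mathscr F}_h(\theta_h)=k^2\mathfrak p\theta_h+k^2d_\dagger\mathscr P_h(\theta_h)+ik\boldsymbol b_\dagger\cdot\nabla\mathscr P_h(\theta_h),$$ let $\boldsymbol{\mathscr R}_h(\theta_h)=\underline{\boldsymbol A}_\dagger\nabla\mathscr P_h(\theta_h)-ik\boldsymbol c_\dagger\mathscr P_h(\theta_h)+\boldsymbol{\mathscr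 F}_h(\theta_h)$, and put $$\rho_h=\max_{\theta_h\in Q_h,\ k\|\theta_h\|_{\mathfrak m}=1}\|\boldsymbol{\mathscr R}_h(\theta_h)\|_{\mathfrak A^{-1}}.$$ **Theorem (Guaranteed bounds).** For all $u\in H^1_{\Gamma_{\rm D}}(\Omega)$, $$\operatorname{Re}\beta\bigl(u,u+2\mathscr P_h(\pi_hu)\bigr)\ \ge\ \Bigl\{1-2\Bigl(\frac{k\mathfrak h}{\mathfrak v}\Bigr)^2-2\rho_h\Bigr\}\,|||u|||^2 ,$$ and $$\inf_{\substack{u\in H^1_{\Gamma_{\rm D}}(\Omega)\\ |||u|||=1}}\ \sup_{\substack{v\in H^1_{\Gamma_{\rm D}}(\Omega)\\ |||v|||=1}}\operatorname{Re}\beta(u,v)\ \ge\ \gamma_h:=\Bigl\{1-2\Bigl(\frac{k\mathfrak h}{\mathfrak v}\Bigr)^2-2\rho_h\Bigr\}\frac1{1+2\Theta_h}.$$ If moreover $\mathfrak p\le\mathfrak m$, both bounds also hold with $\rho_h$ replaced by $\sup\{\|\boldsymbol{\mathscr R}_h(\theta_h)\|_{\mathfrak A^{-1}}:\theta_h\in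 Q_h,\ k\|\theta_h\|_{\mathfrak p}=1\}$, provided that this supremum is finite. -/

import Mathlib

open MeasureTheory Filter Topology
open scoped ContDiff ComplexConjugate

noncomputable section

namespace InfSup

/-! ### Domain -/

/-- `ℝⁿ` with the Euclidean norm. -/
abbrev RVec (n : ℕ) := EuclideanSpace ℝ (Fin n)

/-- `ℂⁿ` with the Hermitian norm. -/
abbrev CVec (n : ℕ) := EuclideanSpace ℂ (Fin n)

/-- Weakly Lipschitz set: near each boundary point, a bi-Lipschitz change of variables maps the
set onto one side of a coordinate hyperplane (and hence the boundary onto the hyperplane). -/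
def IsWeaklyLipschitz {n : ℕ} (Ω : Set (RVec n)) : Prop :=
  ∀ x ∈ frontier Ω, ∃ (e : OpenPartialHomeomorph (RVec n) (RVec n)) (L : NNReal) (i : Fin n),
    x ∈ e.source ∧ LipschitzOnWith L e e.source ∧ LipschitzOnWith L e.symm e.target ∧
    e '' (e.source ∩ Ω) = e.target ∩ {y | y i < 0} ∧
    e '' (e.source ∩ frontier Ω) = e.target ∩ {y | y i = 0}

/-- A nonempty weakly Lipschitz open set whose boundary is split into a Dirichlet and a Neumann
part. That everything is polytopal is part of the definition of a mesh below. -/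
structure Domain (n : ℕ) where
  Ω : Set (RVec n)
  ΓD : Set (RVec n)
  ΓN : Set (RVec n)
  isOpen : IsOpen Ω
  nonempty : Ω.Nonempty
  weaklyLipschitz : IsWeaklyLipschitz Ω
  disjoint : Disjoint ΓD ΓN
  relOpenD : ∃ U : Set (RVec n), IsOpen U ∧ ΓD = U ∩ frontier Ω
  relOpenN : ∃ U : Set (RVec n), IsOpen U ∧ ΓN = U ∩ frontier Ω
  cover : frontier Ω = closure ΓD ∪ closure ΓN

/-! ### Function spaces -/

/-- Complex-valued `L²(Ω)`. -/
abbrev L2 {n : ℕ} (Ω : Set (RVec n)) := Lp ℂ 2 (volume.restrict Ω)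

/-- Complex vector-valued `L²(Ω)`. -/
abbrev L2v {n : ℕ} (Ω : Set (RVec n)) := Lp (CVec n) 2 (volume.restrict Ω)

/-- The classical gradient of a complex-valued function on `ℝⁿ`. -/
def cgrad {n : ℕ} (φ : RVec n → ℂ) (x : RVec n) : CVec n :=
  WithLp.toLp 2 fun i => fderiv ℝ φ x (EuclideanSpace.single i 1)

/-- `φ ∈ C_c^∞(Ω)`. -/
def IsTestFun {n : ℕ} (Ω : Set (RVec n)) (φ : RVec n → ℂ) : Prop :=
  ContDiff ℝ ∞ φ ∧ HasCompactSupport φ ∧ tsupport φ ⊆ Ω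

/-- `G` is the distributional gradient of `u` on `Ω`. -/
def IsWeakGrad {n : ℕ} {Ω : Set (RVec n)} (u : L2 Ω) (G : L2v Ω) : Prop :=
  ∀ φ : RVec n → ℂ, IsTestFun Ω φ → ∀ i : Fin n,
    ∫ x in Ω, u x * cgrad φ x i = - ∫ x in Ω, G x i * φ x

/-- `g` is the distributional divergence of `σ` on `Ω`. -/
def IsWeakDiv {n : ℕ} {Ω : Set (RVec n)} (σ : L2v Ω) (g : L2 Ω) : Prop :=
  ∀ φ : RVec n → ℂ, IsTestFun Ω φ →
    ∫ x in Ω, ∑ i, σ x i * cgrad φ x i = - ∫ x in Ω, g x * φ x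

/-- The function `u` with gradient `G` has vanishing trace on `γ`: it is the limit in `H¹(Ω)` of
functions that are smooth up to the boundary and whose restrictions to `γ` tend to zero in
`L²(γ)`, for the surface measure on `γ`. (The trace is the continuous extension to `H¹(Ω)` of the
restriction to the boundary.) -/
def HasZeroTrace {n : ℕ} {Ω : Set (RVec n)} (γ : Set (RVec n)) (u : L2 Ω) (G : L2v Ω) : Prop :=
  ∃ φ : ℕ → RVec n → ℂ, (∀ j, ContDiff ℝ ∞ (φ j) ∧ HasCompactSupport (φ j)) ∧
    Tendsto (fun j => eLpNorm (fun x => φ j x - u x) 2 (volume.restrict Ω)) atTop (𝓝 0) ∧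
    Tendsto (fun j => eLpNorm (fun x => cgrad (φ j) x - G x) 2 (volume.restrict Ω))
      atTop (𝓝 0) ∧
    Tendsto (fun j => eLpNorm (φ j) 2 ((Measure.hausdorffMeasure ((n : ℝ) - 1)).restrict γ))
      atTop (𝓝 0)

section aux

variable {n : ℕ} {Ω : Set (RVec n)}

theorem integrable_mul_of_memLp {f g : RVec n → ℂ} (hf : MemLp f 2 (volume.restrict Ω))
    (hg : MemLp g 2 (volume.restrict Ω)) :
    Integrable (fun x => f x * g x) (volume.restrict Ω) :=
  hf.integrable_mul hg

theorem memLp_coord (G : L2v Ω) (i : Fin n) :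
    MemLp (fun x => G x i) 2 (volume.restrict Ω) :=
  (PiLp.proj (𝕜 := ℂ) 2 (fun _ : Fin n => ℂ) i).comp_memLp' (Lp.memLp G)

theorem contDiff_cgrad {φ : RVec n → ℂ} (h : ContDiff ℝ ∞ φ) (i : Fin n) :
    ContDiff ℝ ∞ (fun x => cgrad φ x i) := by
  simp only [cgrad]
  exact (h.fderiv_right (m := ∞) (by simp)).clm_apply contDiff_const

theorem memLp_cgrad {φ : RVec n → ℂ} (h : ContDiff ℝ ∞ φ) (hc : HasCompactSupport φ) (i : Fin n) :
    MemLp (fun x => cgrad φ x i) 2 (volume.restrict Ω) := by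
  refine ((contDiff_cgrad h i).continuous.memLp_of_hasCompactSupport ?_).restrict Ω
  refine (hc.fderiv (𝕜 := ℝ)).mono fun x hx => ?_
  contrapose! hx
  simp only [Function.mem_support, not_not] at hx
  simp [cgrad, hx]

theorem memLp_fun {φ : RVec n → ℂ} (h : ContDiff ℝ ∞ φ) (hc : HasCompactSupport φ) :
    MemLp φ 2 (volume.restrict Ω) :=
  (h.continuous.memLp_of_hasCompactSupport hc).restrict Ω

theorem continuous_cgrad {φ : RVec n → ℂ} (h : ContDiff ℝ ∞ φ) : Continuous (cgrad φ) :=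
  (PiLp.continuous_toLp 2 _).comp (continuous_pi fun i => (contDiff_cgrad h i).continuous)

theorem IsWeakGrad.add {u v : L2 Ω} {G H : L2v Ω} (h : IsWeakGrad u G) (h' : IsWeakGrad v H) :
    IsWeakGrad (u + v) (G + H) := by
  intro φ hφ i
  have e1 : ∫ x in Ω, (u + v : L2 Ω) x * cgrad φ x i =
      ∫ x in Ω, (u x * cgrad φ x i + v x * cgrad φ x i) := by
    refine integral_congr_ae ?_
    filter_upwards [Lp.coeFn_add u v] with x hx
    rw [hx, Pi.add_apply, add_mul]
  have e2 : ∫ x in Ω, (G + H : L2v Ω) x i * φ x = ∫ x in Ω, (G x i * φ x + H x i * φ x) := by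
    refine integral_congr_ae ?_
    filter_upwards [Lp.coeFn_add G H] with x hx
    rw [hx, Pi.add_apply, PiLp.add_apply, add_mul]
  have m1 := memLp_cgrad (Ω := Ω) hφ.1 hφ.2.1 i
  have m2 := memLp_fun (Ω := Ω) hφ.1 hφ.2.1
  rw [e1, e2, integral_add (integrable_mul_of_memLp (Lp.memLp u) m1) (integrable_mul_of_memLp (Lp.memLp v) m1),
    integral_add (integrable_mul_of_memLp (memLp_coord G i) m2) (integrable_mul_of_memLp (memLp_coord H i) m2),
    h φ hφ i, h' φ hφ i, neg_add]

theorem IsWeakGrad.smul {u : L2 Ω} {G : L2v Ω} (a : ℂ) (h : IsWeakGrad u G) :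
    IsWeakGrad (a • u) (a • G) := by
  intro φ hφ i
  have e1 : ∫ x in Ω, (a • u : L2 Ω) x * cgrad φ x i = ∫ x in Ω, a * (u x * cgrad φ x i) := by
    refine integral_congr_ae ?_
    filter_upwards [Lp.coeFn_smul a u] with x hx
    rw [hx, Pi.smul_apply, smul_eq_mul, mul_assoc]
  have e2 : ∫ x in Ω, (a • G : L2v Ω) x i * φ x = ∫ x in Ω, a * (G x i * φ x) := by
    refine integral_congr_ae ?_
    filter_upwards [Lp.coeFn_smul a G] with x hx
    rw [hx, Pi.smul_apply, PiLp.smul_apply, smul_eq_mul, mul_assoc]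
  rw [e1, e2, integral_const_mul, integral_const_mul, h φ hφ i, mul_neg]

theorem IsWeakDiv.add {σ τ : L2v Ω} {g g' : L2 Ω} (h : IsWeakDiv σ g) (h' : IsWeakDiv τ g') :
    IsWeakDiv (σ + τ) (g + g') := by
  intro φ hφ
  have e1 : ∫ x in Ω, ∑ i, (σ + τ : L2v Ω) x i * cgrad φ x i =
      ∫ x in Ω, (∑ i, σ x i * cgrad φ x i + ∑ i, τ x i * cgrad φ x i) := by
    refine integral_congr_ae ?_
    filter_upwards [Lp.coeFn_add σ τ] with x hx
    rw [hx, ← Finset.sum_add_distrib]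
    exact Finset.sum_congr rfl fun i _ => by rw [Pi.add_apply, PiLp.add_apply, add_mul]
  have e2 : ∫ x in Ω, (g + g' : L2 Ω) x * φ x = ∫ x in Ω, (g x * φ x + g' x * φ x) := by
    refine integral_congr_ae ?_
    filter_upwards [Lp.coeFn_add g g'] with x hx
    rw [hx, Pi.add_apply, add_mul]
  have m1 := memLp_cgrad (Ω := Ω) hφ.1 hφ.2.1
  have m2 := memLp_fun (Ω := Ω) hφ.1 hφ.2.1
  rw [e1, e2,
    integral_add (integrable_finsetSum _ fun i _ => integrable_mul_of_memLp (memLp_coord σ i) (m1 i))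
      (integrable_finsetSum _ fun i _ => integrable_mul_of_memLp (memLp_coord τ i) (m1 i)),
    integral_add (integrable_mul_of_memLp (Lp.memLp g) m2) (integrable_mul_of_memLp (Lp.memLp g') m2),
    h φ hφ, h' φ hφ, neg_add]

theorem IsWeakDiv.smul {σ : L2v Ω} {g : L2 Ω} (a : ℂ) (h : IsWeakDiv σ g) :
    IsWeakDiv (a • σ) (a • g) := by
  intro φ hφ
  have e1 : ∫ x in Ω, ∑ i, (a • σ : L2v Ω) x i * cgrad φ x i =
      ∫ x in Ω, a * ∑ i, σ x i * cgrad φ x i := by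
    refine integral_congr_ae ?_
    filter_upwards [Lp.coeFn_smul a σ] with x hx
    rw [hx, Finset.mul_sum]
    exact Finset.sum_congr rfl fun i _ => by
      rw [Pi.smul_apply, PiLp.smul_apply, smul_eq_mul, mul_assoc]
  have e2 : ∫ x in Ω, (a • g : L2 Ω) x * φ x = ∫ x in Ω, a * (g x * φ x) := by
    refine integral_congr_ae ?_
    filter_upwards [Lp.coeFn_smul a g] with x hx
    rw [hx, Pi.smul_apply, smul_eq_mul, mul_assoc]
  rw [e1, e2, integral_const_mul, integral_const_mul, h φ hφ, mul_neg]

theorem cgrad_add {φ ψ : RVec n → ℂ} (h : ContDiff ℝ ∞ φ) (h' : ContDiff ℝ ∞ ψ) (x : RVec n) :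
    cgrad (φ + ψ) x = cgrad φ x + cgrad ψ x := by
  ext i
  simp [cgrad, fderiv_add (h.differentiable (by simp) x) (h'.differentiable (by simp) x)]

theorem cgrad_smul {φ : RVec n → ℂ} (a : ℂ) (h : ContDiff ℝ ∞ φ) (x : RVec n) :
    cgrad (a • φ) x = a • cgrad φ x := by
  ext i
  simp [cgrad, fderiv_const_smul (h.differentiable (by simp) x) a]

theorem HasZeroTrace.add {γ : Set (RVec n)} {u v : L2 Ω} {G H : L2v Ω}
    (h : HasZeroTrace γ u G) (h' : HasZeroTrace γ v H) : HasZeroTrace γ (u + v) (G + H) := by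
  obtain ⟨φ, hφ, h1, h2, h3⟩ := h
  obtain ⟨ψ, hψ, k1, k2, k3⟩ := h'
  refine ⟨fun j => φ j + ψ j, fun j => ⟨(hφ j).1.add (hψ j).1, (hφ j).2.add (hψ j).2⟩, ?_, ?_, ?_⟩
  · have := h1.add k1
    rw [add_zero] at this
    refine tendsto_of_tendsto_of_tendsto_of_le_of_le tendsto_const_nhds this
      (fun _ => bot_le) fun j => ?_
    refine le_trans (le_of_eq (eLpNorm_congr_ae ?_)) (eLpNorm_add_le
      ((hφ j).1.continuous.aestronglyMeasurable.sub (Lp.aestronglyMeasurable u))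
      ((hψ j).1.continuous.aestronglyMeasurable.sub (Lp.aestronglyMeasurable v)) (by norm_num))
    filter_upwards [Lp.coeFn_add u v] with x hx
    rw [hx]
    simp only [Pi.add_apply]
    ring
  · have := h2.add k2
    rw [add_zero] at this
    refine tendsto_of_tendsto_of_tendsto_of_le_of_le tendsto_const_nhds this
      (fun _ => bot_le) fun j => ?_
    refine le_trans (le_of_eq (eLpNorm_congr_ae ?_)) (eLpNorm_add_le
      ((continuous_cgrad (hφ j).1).aestronglyMeasurable.sub (Lp.aestronglyMeasurable G))
      ((continuous_cgrad (hψ j).1).aestronglyMeasurable.sub (Lp.aestronglyMeasurable H))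
      (by norm_num))
    filter_upwards [Lp.coeFn_add G H] with x hx
    rw [hx, cgrad_add (hφ j).1 (hψ j).1]
    simp only [Pi.add_apply]
    abel
  · have := h3.add k3
    rw [add_zero] at this
    refine tendsto_of_tendsto_of_tendsto_of_le_of_le tendsto_const_nhds this
      (fun _ => bot_le) fun j => ?_
    exact eLpNorm_add_le (hφ j).1.continuous.aestronglyMeasurable
      (hψ j).1.continuous.aestronglyMeasurable (by norm_num)

theorem HasZeroTrace.smul {γ : Set (RVec n)} {u : L2 Ω} {G : L2v Ω} (a : ℂ)
    (h : HasZeroTrace γ u G) : HasZeroTrace γ (a • u) (a • G) := by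
  obtain ⟨φ, hφ, h1, h2, h3⟩ := h
  have key : ∀ {f : ℕ → ENNReal}, Tendsto f atTop (𝓝 0) →
      Tendsto (fun j => ‖a‖ₑ * f j) atTop (𝓝 0) := fun hf => by
    simpa using ENNReal.Tendsto.const_mul hf (Or.inr enorm_ne_top)
  refine ⟨fun j => a • φ j, fun j => ⟨(hφ j).1.const_smul a, (hφ j).2.smul_left⟩, ?_, ?_, ?_⟩
  · refine (key h1).congr fun j => ?_
    rw [← eLpNorm_const_smul]
    refine eLpNorm_congr_ae ?_
    filter_upwards [Lp.coeFn_smul a u] with x hx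
    rw [hx]
    simp only [Pi.smul_apply, smul_sub]
  · refine (key h2).congr fun j => ?_
    rw [← eLpNorm_const_smul]
    refine eLpNorm_congr_ae ?_
    filter_upwards [Lp.coeFn_smul a G] with x hx
    rw [hx, cgrad_smul a (hφ j).1]
    simp only [Pi.smul_apply, smul_sub]
  · refine (key h3).congr fun j => ?_
    rw [← eLpNorm_const_smul]

theorem isWeakGrad_zero : IsWeakGrad (0 : L2 Ω) (0 : L2v Ω) := by
  intro φ _ i
  rw [integral_eq_zero_of_ae, integral_eq_zero_of_ae, neg_zero]
  · filter_upwards [Lp.coeFn_zero (CVec n) 2 (volume.restrict Ω)] with x hx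
    simp only [hx, Pi.zero_apply]; simp
  · filter_upwards [Lp.coeFn_zero ℂ 2 (volume.restrict Ω)] with x hx
    simp only [hx, Pi.zero_apply]; simp

theorem isWeakDiv_zero : IsWeakDiv (0 : L2v Ω) (0 : L2 Ω) := by
  intro φ _
  rw [integral_eq_zero_of_ae, integral_eq_zero_of_ae, neg_zero]
  · filter_upwards [Lp.coeFn_zero ℂ 2 (volume.restrict Ω)] with x hx
    simp only [hx, Pi.zero_apply]; simp
  · filter_upwards [Lp.coeFn_zero (CVec n) 2 (volume.restrict Ω)] with x hx
    simp only [hx, Pi.zero_apply]; simp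

theorem hasZeroTrace_zero (γ : Set (RVec n)) : HasZeroTrace γ (0 : L2 Ω) (0 : L2v Ω) := by
  refine ⟨fun _ => 0, fun _ => ⟨contDiff_const, HasCompactSupport.zero⟩, ?_, ?_, ?_⟩
  · refine tendsto_const_nhds.congr fun j => ?_
    rw [eLpNorm_congr_ae (g := fun _ => (0 : ℂ)), eLpNorm_zero']
    filter_upwards [Lp.coeFn_zero ℂ 2 (volume.restrict Ω)] with x hx
    simp only [hx, Pi.zero_apply]; simp
  · refine tendsto_const_nhds.congr fun j => ?_
    rw [eLpNorm_congr_ae (g := fun _ => (0 : CVec n)), eLpNorm_zero']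
    filter_upwards [Lp.coeFn_zero (CVec n) 2 (volume.restrict Ω)] with x hx
    rw [hx]
    ext i
    simp [cgrad]
  · simp

/-- The expression `(σ, ∇w)_Ω + (div σ, w)_Ω` for pairs `(σ, div σ)` and `(w, ∇w)`. -/
def divPairing (s : L2v Ω × L2 Ω) (w : L2 Ω × L2v Ω) : ℂ :=
  ∫ x in Ω, (∑ i, s.1 x i * conj (w.2 x i) + s.2 x * conj (w.1 x))

theorem integrable_divPairing (s : L2v Ω × L2 Ω) (w : L2 Ω × L2v Ω) :
    Integrable (fun x => ∑ i, s.1 x i * conj (w.2 x i) + s.2 x * conj (w.1 x))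
      (volume.restrict Ω) :=
  (integrable_finsetSum _ fun i _ =>
    integrable_mul_of_memLp (memLp_coord s.1 i) (memLp_coord w.2 i).star).add
    (integrable_mul_of_memLp (Lp.memLp s.2) (Lp.memLp w.1).star)

theorem divPairing_add (s t : L2v Ω × L2 Ω) (w : L2 Ω × L2v Ω) :
    divPairing (s + t) w = divPairing s w + divPairing t w := by
  simp only [divPairing]
  rw [← integral_add (integrable_divPairing s w) (integrable_divPairing t w)]
  refine integral_congr_ae ?_
  filter_upwards [Lp.coeFn_add s.1 t.1, Lp.coeFn_add s.2 t.2] with x hx hx'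
  simp only [Prod.fst_add, Prod.snd_add, hx, hx', Pi.add_apply, PiLp.add_apply, add_mul,
    Finset.sum_add_distrib]
  ring

theorem divPairing_smul (a : ℂ) (s : L2v Ω × L2 Ω) (w : L2 Ω × L2v Ω) :
    divPairing (a • s) w = a * divPairing s w := by
  simp only [divPairing]
  rw [← integral_const_mul]
  refine integral_congr_ae ?_
  filter_upwards [Lp.coeFn_smul a s.1, Lp.coeFn_smul a s.2] with x hx hx'
  simp only [Prod.smul_fst, Prod.smul_snd, hx, hx', Pi.smul_apply, PiLp.smul_apply, smul_eq_mul,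
    mul_add, Finset.mul_sum, mul_assoc]

end aux

/-- `H¹_γ(Ω)`, realized as the set of pairs `(u, ∇u)`. -/
def H1zero {n : ℕ} (Ω γ : Set (RVec n)) : Submodule ℂ (L2 Ω × L2v Ω) where
  carrier := {w | IsWeakGrad w.1 w.2 ∧ HasZeroTrace γ w.1 w.2}
  zero_mem' := ⟨isWeakGrad_zero, hasZeroTrace_zero γ⟩
  add_mem' := fun h h' => ⟨h.1.add h'.1, h.2.add h'.2⟩
  smul_mem' := fun a _ h => ⟨h.1.smul a, h.2.smul a⟩

/-- The fields in `H(div, Ω)` whose normal trace vanishes on the part of the boundary complementary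
to `γ`, realized as the set of pairs `(σ, div σ)`. The vanishing of the normal trace is, as usual,
understood by duality with the functions of `H¹(Ω)` whose trace vanishes on `γ`. -/
def HdivZero {n : ℕ} (Ω γ : Set (RVec n)) : Submodule ℂ (L2v Ω × L2 Ω) where
  carrier := {s | IsWeakDiv s.1 s.2 ∧ ∀ w ∈ H1zero Ω γ, divPairing s w = 0}
  zero_mem' := ⟨isWeakDiv_zero, fun w _ => by
    simpa using divPairing_smul (0 : ℂ) (0 : L2v Ω × L2 Ω) w⟩
  add_mem' := fun h h' => ⟨h.1.add h'.1, fun w hw => by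
    rw [divPairing_add, h.2 w hw, h'.2 w hw, add_zero]⟩
  smul_mem' := fun a _ h => ⟨h.1.smul a, fun w hw => by
    rw [divPairing_smul, h.2 w hw, mul_zero]⟩

/-! ### Mesh and finite element spaces -/

/-- The open simplex with vertex set `K`. -/
def elem {n : ℕ} (K : Finset (RVec n)) : Set (RVec n) := interior (convexHull ℝ (K : Set (RVec n)))

/-- A matching simplicial mesh of the domain; an element is given by its set of vertices.
`matching` says that two closed elements meet in the closed subsimplex spanned by their common
vertices (the empty set if there are none). -/
structure Mesh {n : ℕ} (G : Domain n) where
  elems : Finset (Finset (RVec n))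
  card_eq : ∀ K ∈ elems, K.card = n + 1
  affineIndep : ∀ K ∈ elems, AffineIndependent ℝ ((↑) : K → RVec n)
  matching : ∀ K ∈ elems, ∀ K' ∈ elems,
    convexHull ℝ (K : Set (RVec n)) ∩ convexHull ℝ (K' : Set (RVec n)) =
      convexHull ℝ ((K : Set (RVec n)) ∩ (K' : Set (RVec n)))
  subset : ∀ K ∈ elems, elem K ⊆ G.Ω
  conforming : closure G.Ω = ⋃ K ∈ elems, convexHull ℝ (K : Set (RVec n))
  boundaryFaces : ∀ K ∈ elems, ∀ F ⊆ K, F.card = n →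
    convexHull ℝ (F : Set (RVec n)) ⊆ frontier G.Ω →
      intrinsicInterior ℝ (convexHull ℝ (F : Set (RVec n))) ⊆ G.ΓD ∨
      intrinsicInterior ℝ (convexHull ℝ (F : Set (RVec n))) ⊆ G.ΓN

variable {n : ℕ} {G : Domain n}

theorem Mesh.ae_elem (M : Mesh G) {K : Finset (RVec n)} (hK : K ∈ M.elems)
    {P : RVec n → Prop} (h : ∀ᵐ x ∂(volume.restrict G.Ω), P x) :
    ∀ᵐ x ∂(volume.restrict (elem K)), P x :=
  ae_restrict_of_ae_restrict_of_subset (M.subset K hK) h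

/-- Almost every point of the domain lies in an element. -/
theorem Mesh.ae_exists_elem (M : Mesh G) :
    ∀ᵐ x ∂(volume.restrict G.Ω), ∃ K ∈ M.elems, x ∈ elem K := by
  have h0 : ∀ᵐ x : RVec n, ∀ K ∈ M.elems, x ∉ frontier (convexHull ℝ (K : Set (RVec n))) := by
    rw [Finset.eventually_all]
    intro K _
    exact measure_eq_zero_iff_ae_notMem.1 ((convex_convexHull ℝ (K : Set (RVec n))).addHaar_frontier
      volume)
  filter_upwards [ae_restrict_of_ae h0, ae_restrict_mem G.isOpen.measurableSet] with x hx hxΩ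
  have hx' : x ∈ ⋃ K ∈ M.elems, convexHull ℝ (K : Set (RVec n)) :=
    M.conforming ▸ subset_closure hxΩ
  simp only [Set.mem_iUnion, exists_prop] at hx'
  obtain ⟨K, hK, hxK⟩ := hx'
  refine ⟨K, hK, ?_⟩
  by_contra hcon
  exact hx K hK ⟨subset_closure hxK, hcon⟩

/-- Distinct (open) elements are disjoint. -/
theorem Mesh.elem_disjoint (M : Mesh G) (K : Finset (RVec n)) (hK : K ∈ M.elems)
    (K' : Finset (RVec n)) (hK' : K' ∈ M.elems) (x : RVec n) (hx : x ∈ elem K)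
    (hx' : x ∈ elem K') : K = K' := by
  classical
  have h1 : (interior (convexHull ℝ ((K ∩ K' : Finset (RVec n)) : Set (RVec n)))).Nonempty := by
    refine ⟨x, ?_⟩
    rw [Finset.coe_inter, ← M.matching K hK K' hK', interior_inter]
    exact ⟨hx, hx'⟩
  rw [interior_convexHull_nonempty_iff_affineSpan_eq_top] at h1
  have hne : (K ∩ K').Nonempty := by
    rw [Finset.nonempty_iff_ne_empty]
    intro h
    rw [h, Finset.coe_empty, AffineSubspace.span_empty] at h1
    exact bot_ne_top h1
  obtain ⟨m, hm⟩ : ∃ m, (K ∩ K').card = m + 1 := Nat.exists_eq_add_one.2 hne.card_pos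
  have h2 := finrank_vectorSpan_image_finset_le ℝ (id : RVec n → RVec n) (K ∩ K') hm
  rw [Finset.image_id, ← direction_affineSpan, h1, AffineSubspace.direction_top, finrank_top,
    finrank_euclideanSpace_fin] at h2
  have hKc := M.card_eq K hK
  have hKc' := M.card_eq K' hK'
  have e1 : K ∩ K' = K := Finset.eq_of_subset_of_card_le Finset.inter_subset_left (by omega)
  have e2 : K ∩ K' = K' := Finset.eq_of_subset_of_card_le Finset.inter_subset_right (by omega)
  exact e1.symm.trans e2

/-- Piecewise polynomials of degree at most `r`, as elements of `L²(Ω)`. -/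
def Mesh.PwPoly (M : Mesh G) (r : ℕ) : Submodule ℂ (L2 G.Ω) where
  carrier := {θ | ∀ K ∈ M.elems, ∃ P : MvPolynomial (Fin n) ℂ, P.totalDegree ≤ r ∧
    ∀ᵐ x ∂(volume.restrict (elem K)), θ x = MvPolynomial.eval (fun i => (x i : ℂ)) P}
  zero_mem' := fun K hK => ⟨0, by simp, by
    filter_upwards [M.ae_elem hK (Lp.coeFn_zero ℂ 2 (volume.restrict G.Ω))] with x hx
    simpa using hx⟩
  add_mem' := fun {θ η} h h' K hK => by
    obtain ⟨P, hP, e⟩ := h K hK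
    obtain ⟨P', hP', e'⟩ := h' K hK
    refine ⟨P + P', (MvPolynomial.totalDegree_add _ _).trans (max_le hP hP'), ?_⟩
    filter_upwards [M.ae_elem hK (Lp.coeFn_add θ η), e, e'] with x hx h1 h2
    rw [hx, Pi.add_apply, h1, h2, map_add]
  smul_mem' := fun a θ h K hK => by
    obtain ⟨P, hP, e⟩ := h K hK
    refine ⟨a • P, (MvPolynomial.totalDegree_smul_le _ _).trans hP, ?_⟩
    filter_upwards [M.ae_elem hK (Lp.coeFn_smul a θ), e] with x hx h1
    rw [hx, Pi.smul_apply, h1, MvPolynomial.smul_eval, smul_eq_mul]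

/-- The Lagrange space of degree `r`: functions of `H¹_{Γ_D}(Ω)` that are piecewise polynomials. -/
def Mesh.Lagrange (M : Mesh G) (r : ℕ) : Submodule ℂ (L2 G.Ω × L2v G.Ω) :=
  H1zero G.Ω G.ΓD ⊓ (M.PwPoly r).comap (LinearMap.fst ℂ (L2 G.Ω) (L2v G.Ω))

theorem continuous_evalPoly (P : MvPolynomial (Fin n) ℂ) :
    Continuous fun x : RVec n => MvPolynomial.eval (fun i => (x i : ℂ)) P :=
  (MvPolynomial.continuous_eval P).comp (by fun_prop)

/-- The class of the function that agrees with the polynomial `P` on the element `K`. -/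
def polyOn (Ω : Set (RVec n)) (K : Finset (RVec n)) :
    MvPolynomial (Fin n) ℂ →ₗ[ℂ] (RVec n →ₘ[volume.restrict Ω] ℂ) where
  toFun P := AEEqFun.mk ((elem K).indicator fun x => MvPolynomial.eval (fun i => (x i : ℂ)) P)
    ((continuous_evalPoly P).aestronglyMeasurable.indicator isOpen_interior.measurableSet)
  map_add' P P' := by
    rw [AEEqFun.mk_add_mk]
    congr 1
    funext x
    by_cases hx : x ∈ elem K <;> simp [hx]
  map_smul' a P := by
    rw [RingHom.id_apply, AEEqFun.smul_mk]
    congr 1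
    funext x
    by_cases hx : x ∈ elem K <;> simp [hx, MvPolynomial.smul_eval]

instance (M : Mesh G) (r : ℕ) : FiniteDimensional ℂ (M.PwPoly r) := by
  classical
  let ι : M.PwPoly r →ₗ[ℂ] (RVec n →ₘ[volume.restrict G.Ω] ℂ) :=
    { toFun := fun θ => ((θ : L2 G.Ω) : RVec n →ₘ[volume.restrict G.Ω] ℂ)
      map_add' := fun _ _ => rfl
      map_smul' := fun _ _ => rfl }
  have hι : Function.Injective ι := fun θ η h => Subtype.ext (Subtype.ext h)
  let S : Submodule ℂ (RVec n →ₘ[volume.restrict G.Ω] ℂ) :=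
    ⨆ K : M.elems, (MvPolynomial.restrictTotalDegree (Fin n) ℂ r).map (polyOn G.Ω K)
  have hS : FiniteDimensional ℂ S := Submodule.finiteDimensional_iSup _
  have hmem : ∀ θ, ι θ ∈ S := by
    intro θ
    choose P hP e using θ.2
    have key : ι θ = ∑ K ∈ M.elems.attach, polyOn G.Ω K (P K K.2) := by
      have hsum : ((∑ K ∈ M.elems.attach, polyOn G.Ω K (P K K.2) :
          RVec n →ₘ[volume.restrict G.Ω] ℂ) : RVec n → ℂ) =ᵐ[volume.restrict G.Ω]
          fun x => ∑ K ∈ M.elems.attach, (elem (K : Finset (RVec n))).indicator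
            (fun x => MvPolynomial.eval (fun i => (x i : ℂ)) (P K K.2)) x := by
        induction M.elems.attach using Finset.induction_on with
        | empty =>
          simp only [Finset.sum_empty]
          exact AEEqFun.coeFn_zero
        | insert a t ha ih =>
          rw [Finset.sum_insert ha]
          refine (AEEqFun.coeFn_add _ _).trans ?_
          filter_upwards [ih, AEEqFun.coeFn_mk (μ := volume.restrict G.Ω)
            ((elem (a : Finset (RVec n))).indicator
              fun x => MvPolynomial.eval (fun i => (x i : ℂ)) (P a a.2))
            ((continuous_evalPoly _).aestronglyMeasurable.indicator
              isOpen_interior.measurableSet)] with x h1 h2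
          rw [Pi.add_apply, Finset.sum_insert ha, h1]
          exact congrArg (· + _) h2
      refine AEEqFun.ext (EventuallyEq.trans ?_ hsum.symm)
      have hall : ∀ᵐ x ∂(volume.restrict G.Ω), ∀ K : M.elems, x ∈ elem (K : Finset (RVec n)) →
          (θ : L2 G.Ω) x = MvPolynomial.eval (fun i => (x i : ℂ)) (P K K.2) := by
        rw [ae_all_iff]
        intro K
        exact ae_restrict_of_ae ((ae_restrict_iff' isOpen_interior.measurableSet).1 (e K K.2))
      filter_upwards [hall, M.ae_exists_elem] with x hx hex
      obtain ⟨K, hK, hxK⟩ := hex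
      rw [Finset.sum_eq_single ⟨K, hK⟩, Set.indicator_of_mem hxK]
      · exact hx ⟨K, hK⟩ hxK
      · intro K' _ hne
        refine Set.indicator_of_notMem (fun h => hne ?_) _
        exact Subtype.ext (M.elem_disjoint _ K'.2 _ hK x h hxK)
      · exact fun h => absurd (Finset.mem_attach _ _) h
    rw [key]
    exact Submodule.sum_mem _ fun K _ => Submodule.mem_iSup_of_mem K
      ⟨_, (MvPolynomial.mem_restrictTotalDegree _ _ _).2 (hP K K.2), rfl⟩
  refine Module.Finite.of_injective (ι.codRestrict S hmem) fun a b h => hι ?_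
  exact congrArg (fun z : S => (z : RVec n →ₘ[volume.restrict G.Ω] ℂ)) h

/-- The `L²(Ω)`-orthogonal projection onto piecewise polynomials of degree at most `q`. -/
def Mesh.proj (M : Mesh G) (q : ℕ) (θ : L2 G.Ω) : M.PwPoly q :=
  (M.PwPoly q).orthogonalProjectionOnto θ

/-- The diameter `h_K` of an element. -/
def elemDiam (K : Finset (RVec n)) : ℝ := Metric.diam (elem K)

/-- `f` is constant on each element. -/
def Mesh.IsPwConst (M : Mesh G) {X : Type*} (f : RVec n → X) : Prop :=
  ∀ K ∈ M.elems, ∀ x ∈ elem K, ∀ y ∈ elem K, f x = f y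

/-! ### Coefficients, sesquilinear form and norms -/

/-- The wavenumber, the coefficients of the equation, and the weights of the energy norm. -/
structure Coeffs (M : Mesh G) where
  k : ℝ
  A : RVec n → Matrix (Fin n) (Fin n) ℂ
  b : RVec n → Fin n → ℂ
  c : RVec n → Fin n → ℂ
  d : RVec n → ℂ
  wm : RVec n → ℝ
  wp : RVec n → ℝ
  wA : RVec n → Matrix (Fin n) (Fin n) ℝ
  k_pos : 0 < k
  A_const : M.IsPwConst A
  b_const : M.IsPwConst b
  c_const : M.IsPwConst c
  d_const : M.IsPwConst d
  wm_const : M.IsPwConst wm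
  wp_const : M.IsPwConst wp
  wA_const : M.IsPwConst wA
  wm_pos : ∀ K ∈ M.elems, ∀ x ∈ elem K, 0 < wm x
  wp_nonneg : ∀ K ∈ M.elems, ∀ x ∈ elem K, 0 ≤ wp x
  wA_posDef : ∀ K ∈ M.elems, ∀ x ∈ elem K, (wA x).PosDef
  wp_ne_zero : ∃ K ∈ M.elems, ∃ x ∈ elem K, wp x ≠ 0

/-- The weighted norm `‖v‖_{w,Ω}`. -/
def wnorm (Ω : Set (RVec n)) (w : RVec n → ℝ) (v : RVec n → ℂ) : ℝ :=
  √(∫ x in Ω, w x * ‖v x‖ ^ 2)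

/-- The weighted norm `‖v‖_{W,Ω}` of a vector field, for a symmetric matrix weight. -/
def wnormV (Ω : Set (RVec n)) (W : RVec n → Matrix (Fin n) (Fin n) ℝ) (v : RVec n → CVec n) : ℝ :=
  √(∫ x in Ω, (∑ i, (∑ j, (W x i j : ℂ) * v x j) * conj (v x i)).re)

namespace Coeffs

variable {M : Mesh G} (D : Coeffs M)

/-- The sesquilinear form `β(u, v)`. -/
def beta (u v : L2 G.Ω × L2v G.Ω) : ℂ :=
  (∫ x in G.Ω, (-(D.k : ℂ) ^ 2 * D.d x * u.1 x
      + Complex.I * D.k * ∑ i, D.c x i * u.2 x i) * conj (v.1 x)) +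
  ∫ x in G.Ω, ∑ i, (Complex.I * D.k * D.b x i * u.1 x + ∑ j, D.A x i j * u.2 x j)
      * conj (v.2 x i)

/-- The energy norm. -/
def energy (u : L2 G.Ω × L2v G.Ω) : ℝ :=
  √(D.k ^ 2 * wnorm G.Ω D.wm u.1 ^ 2 + wnormV G.Ω D.wA u.2 ^ 2)

/-- The Gårding inequality on `H¹_{Γ_D}(Ω)`. -/
def Garding : Prop :=
  ∀ u ∈ H1zero G.Ω G.ΓD,
    D.energy u ^ 2 - 2 * D.k ^ 2 * wnorm G.Ω D.wp u.1 ^ 2 ≤ (D.beta u u).re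

/-- The inf-sup constant of `β` on `H¹_{Γ_D}(Ω)` in the energy norm. -/
def infSup : EReal :=
  ⨅ u ∈ {u | u ∈ H1zero G.Ω G.ΓD ∧ D.energy u = 1},
    ⨆ v ∈ {v | v ∈ H1zero G.Ω G.ΓD ∧ D.energy v = 1}, (((D.beta u v).re : ℝ) : EReal)

/-! ### Element quantities -/

/-- The constant value of `𝔭` on the element `K`, read at the barycentre. -/
def pOn (K : Finset (RVec n)) : ℝ := D.wp (K.centroid ℝ id)

/-- The smallest eigenvalue of the constant value of `𝔄` on the element `K`. -/
def alphaMin (K : Finset (RVec n)) : ℝ := sInf (spectrum ℝ (D.wA (K.centroid ℝ id)))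

/-- The reciprocal `1 / ϑ_K = √(p_K / α_K)` of the wavespeed `ϑ_K = √(α_K / p_K)` (zero where
`p_K = 0`, that is, where the wavespeed is infinite). -/
def invSpeed (K : Finset (RVec n)) : ℝ := √(D.pOn K / D.alphaMin K)

/-! ### Discrete solution operator and flux reconstruction -/

/-- `z` solves the discrete adjoint problem with datum `θ`. -/
def IsDiscreteSol (r : ℕ) (θ : L2 G.Ω) (z : M.Lagrange r) : Prop :=
  ∀ w ∈ M.Lagrange r, D.beta w z = (D.k : ℂ) ^ 2 * ∫ x in G.Ω, (D.wp x : ℂ) * w.1 x * conj (θ x)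

/-- Well-posedness of the discrete problem for all data in `Q_h`. -/
def DiscreteWellPosed (r q : ℕ) : Prop :=
  ∀ θ : M.PwPoly q, ∃! z : M.Lagrange r, D.IsDiscreteSol r θ z

variable {D} in
/-- The discrete solution operator. -/
def DiscreteWellPosed.sol {r q : ℕ} (h : D.DiscreteWellPosed r q) (θ : M.PwPoly q) :
    M.Lagrange r :=
  (h θ).choose

/-- The operator norm `Θ_h` of the discrete solution operator (a maximum, as `Q_h` is nonzero and
finite-dimensional). -/
def thetaH {r q : ℕ} (h : D.DiscreteWellPosed r q) : ℝ :=
  sSup {t | ∃ θ : M.PwPoly q, D.k * wnorm G.Ω D.wm (θ : L2 G.Ω) = 1 ∧ t = D.energy (h.sol θ)}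

/-- A flux reconstruction: a linear map into `H_{Γ_N}(div, Ω)` with prescribed divergence. -/
def IsFluxReconstruction {r q : ℕ} (h : D.DiscreteWellPosed r q)
    (F : M.PwPoly q →ₗ[ℂ] HdivZero G.Ω G.ΓD) : Prop :=
  ∀ θ : M.PwPoly q, ∀ᵐ x ∂(volume.restrict G.Ω),
    (F θ).1.2 x = (D.k : ℂ) ^ 2 * D.wp x * (θ : L2 G.Ω) x
      + (D.k : ℂ) ^ 2 * conj (D.d x) * (h.sol θ).1.1 x
      + Complex.I * D.k * ∑ i, conj (D.b x i) * (h.sol θ).1.2 x i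

/-- The residual `A† ∇P_h θ - i k c† P_h θ + F_h θ`. -/
def residual {r q : ℕ} (h : D.DiscreteWellPosed r q)
    (F : M.PwPoly q →ₗ[ℂ] HdivZero G.Ω G.ΓD) (θ : M.PwPoly q) (x : RVec n) : CVec n :=
  WithLp.toLp 2 fun i =>
    ∑ j, (D.A x).conjTranspose i j * (h.sol θ).1.2 x j
      - Complex.I * D.k * conj (D.c x i) * (h.sol θ).1.1 x + (F θ).1.1 x i

/-- The set of norms `‖R_h(θ)‖_{𝔄⁻¹,Ω}` for `θ ∈ Q_h` with `k ‖θ‖_{w,Ω} = 1`. -/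
def residualNorms {r q : ℕ} (h : D.DiscreteWellPosed r q)
    (F : M.PwPoly q →ₗ[ℂ] HdivZero G.Ω G.ΓD) (w : RVec n → ℝ) : Set ℝ :=
  {t | ∃ θ : M.PwPoly q, D.k * wnorm G.Ω w (θ : L2 G.Ω) = 1 ∧
    t = wnormV G.Ω (fun x => (D.wA x)⁻¹) (D.residual h F θ)}

/-- The residual constant `ρ_h`, for data normalized by `k ‖θ‖_{w,Ω} = 1` (a maximum if `w > 0`, as
`Q_h` is nonzero and finite-dimensional). -/
def rhoH {r q : ℕ} (h : D.DiscreteWellPosed r q)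
    (F : M.PwPoly q →ₗ[ℂ] HdivZero G.Ω G.ΓD) (w : RVec n → ℝ) : ℝ :=
  sSup (D.residualNorms h F w)

end Coeffs

end InfSup

end

noncomputable section

namespace InfSup

/-! ### A Poincaré inequality on convex sets -/

section Poincare

variable {n : ℕ}

/-! The Gårding inequality misses coercivity only by `2k²‖u‖_𝔭²`, and the test function `u + 2
P_h(π_h u)` is built to give this term back. An exact adjoint solution operator `P` would satisfy
`β(u, Pθ) = k²(𝔭u, θ)`. For the discrete one, the prescribed divergence of the flux and an
integration by parts against `u` (without boundary term, since `u` vanishes on `Γ_D` and the normal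
flux on `Γ_N`) give `β(u, P_h θ) = k²(𝔭u, θ) + (∇u, R_h θ)`, which is `Coeffs.beta_sol`. This holds
for every `u ∈ H¹_{Γ_D}` without any Galerkin orthogonality; the discrete equation enters through
its unique solvability, which makes `P_h` linear.

Take `θ = π_h u`. Since `𝔭` is constant on elements, multiplication by `𝔭` maps `Q_h` to itself, so
`π_h` is orthogonal for the `𝔭`-weighted form too: `(𝔭u, π_h u) = ‖π_h u‖_𝔭²` and `‖u‖_𝔭² = ‖u - π_h
u‖_𝔭² + ‖π_h u‖_𝔭²`. Of the defect only `2k²‖u - π_h u‖_𝔭²` survives, together with twice the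
residual term. By Cauchy–Schwarz in the weights `𝔄⁻¹` and `𝔄`, the residual term is at most `ρ_h
k‖π_h u‖_𝔪 ‖∇u‖_𝔄 ≤ ρ_h |||u|||²`. The arithmetic is in `Coeffs.le_of_estimates`.

The projection error is at most `(𝔥/𝔳)‖∇u‖_𝔄` (`Coeffs.norm_sqrtOp_sub_proj_le`): for smooth
functions, compare with the element means and use a Poincaré inequality on each simplex; then pass
to the limit. The Poincaré constant needed is the diameter itself, and
`integral_norm_sub_mean_sq_le` obtains it by integrating `|φ(x) - φ(y)|²` over pairs of points and
bounding the differences along segments.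

For the inf-sup bound, `|||u + 2 P_h(π_h u)||| ≤ 1 + 2Θ_h` when `|||u||| = 1`, so it suffices to
normalize the test function (`Coeffs.le_infSup`).

Weighted norms are handled as ordinary `L²` norms after multiplication by a square root of the
weight (`sqrtOp`, `rootOp`), so that orthogonality and Cauchy–Schwarz are those of the Hilbert
space. -/

theorem norm_fderiv_apply_le_cgrad (φ : RVec n → ℂ) (z v : RVec n) :
    ‖fderiv ℝ φ z v‖ ≤ ‖v‖ * ‖cgrad φ z‖ := by
  have h1 : fderiv ℝ φ z v = ∑ i, (v i : ℂ) * cgrad φ z i := by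
    have hv : v = ∑ i, v i • EuclideanSpace.single i (1 : ℝ) := by
      ext j
      simp [Finset.sum_apply, Pi.single_apply]
    conv_lhs => rw [hv]
    simp only [map_sum, map_smul, cgrad, Complex.real_smul]
  rw [h1]
  refine (norm_sum_le _ _).trans ?_
  simp only [norm_mul, Complex.norm_real]
  rw [EuclideanSpace.norm_eq, EuclideanSpace.norm_eq]
  exact Real.sum_mul_le_sqrt_mul_sqrt _ _ _

/-- Jensen's inequality on the unit interval: the variance of `f` is nonnegative. -/
theorem integral_sq_le_integral_sq {f : ℝ → ℝ} (hf : Continuous f) :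
    (∫ t in (0 : ℝ)..1, f t) ^ 2 ≤ ∫ t in (0 : ℝ)..1, f t ^ 2 := by
  set c := ∫ t in (0 : ℝ)..1, f t with hc
  have h : 0 ≤ ∫ t in (0 : ℝ)..1, (f t - c) ^ 2 :=
    intervalIntegral.integral_nonneg zero_le_one fun t _ => sq_nonneg _
  have e : ∫ t in (0 : ℝ)..1, (f t - c) ^ 2 = (∫ t in (0 : ℝ)..1, f t ^ 2) - c ^ 2 := by
    have : ∀ t, (f t - c) ^ 2 = f t ^ 2 - 2 * c * f t + c ^ 2 := fun t => by ring
    simp only [this]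
    rw [intervalIntegral.integral_add, intervalIntegral.integral_sub,
      intervalIntegral.integral_const_mul, ← hc]
    · simp
      ring
    all_goals exact Continuous.intervalIntegrable (by fun_prop) _ _
  linarith

/-- The fundamental theorem of calculus along the segment, followed by Jensen. The bound is a lower
Lebesgue integral so that Tonelli applies later without integrability conditions. -/
theorem norm_sub_sq_le_segment {φ : RVec n → ℂ} (h : ContDiff ℝ ∞ φ) (x y : RVec n) :
    ENNReal.ofReal (‖φ x - φ y‖ ^ 2) ≤
      ∫⁻ t in Set.Ioc (0 : ℝ) 1,
        ENNReal.ofReal (‖x - y‖ ^ 2 * ‖cgrad φ ((1 - t) • x + t • y)‖ ^ 2) := by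
  have hcg := continuous_cgrad h
  let γ : ℝ → RVec n := fun t => (1 - t) • x + t • y
  have hγ : ∀ t, HasDerivAt γ (y - x) t := fun t => by
    have h1 : HasDerivAt (fun t : ℝ => (1 - t) • x) ((-1 : ℝ) • x) t :=
      ((hasDerivAt_id t).const_sub 1).smul_const x
    have h2 : HasDerivAt (fun t : ℝ => t • y) ((1 : ℝ) • y) t := (hasDerivAt_id t).smul_const y
    have h3 := h1.add h2
    rwa [neg_smul, one_smul, one_smul, neg_add_eq_sub] at h3
  have hγc : Continuous γ := by fun_prop
  have hd : Continuous fun t => fderiv ℝ φ (γ t) (y - x) :=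
    ((h.continuous_fderiv (by simp)).comp hγc).clm_apply continuous_const
  have e : ∫ t in (0 : ℝ)..1, fderiv ℝ φ (γ t) (y - x) = φ y - φ x := by
    rw [intervalIntegral.integral_eq_sub_of_hasDerivAt (f := fun t => φ (γ t))
      (fun t _ => ?_) (hd.intervalIntegrable _ _)]
    · simp [γ]
    · exact ((h.differentiable (by simp) (γ t)).hasFDerivAt.comp_hasDerivAt t (hγ t))
  have hg : Continuous fun t => ‖x - y‖ * ‖cgrad φ (γ t)‖ := by fun_prop
  have b1 : ‖φ x - φ y‖ ≤ ∫ t in (0 : ℝ)..1, ‖x - y‖ * ‖cgrad φ (γ t)‖ := by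
    rw [norm_sub_rev, ← e]
    refine (intervalIntegral.norm_integral_le_integral_norm zero_le_one).trans
      (intervalIntegral.integral_mono_on zero_le_one (hd.norm.intervalIntegrable _ _)
        (hg.intervalIntegrable _ _) fun t _ => ?_)
    rw [norm_sub_rev x y]
    exact norm_fderiv_apply_le_cgrad φ (γ t) (y - x)
  have b2 := (pow_le_pow_left₀ (norm_nonneg _) b1 2).trans (integral_sq_le_integral_sq hg)
  refine (ENNReal.ofReal_le_ofReal b2).trans (le_of_eq ?_)
  rw [intervalIntegral.integral_of_le zero_le_one, ofReal_integral_eq_lintegral_ofReal]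
  · simp only [mul_pow, γ]
  · exact ((hg.pow 2).integrableOn_Icc).mono_set Set.Ioc_subset_Icc_self
  · exact Eventually.of_forall fun t => sq_nonneg _

/-- The kernel that remains after integrating along segments. -/
theorem lintegral_kernel_le {s h : ℝ} (hs : 0 ≤ s) (hh : 0 < h) :
    ∫⁻ t in Set.Ioc (0 : ℝ) (1 / 2),
      ENNReal.ofReal (if s ≤ (1 - t) * h then ((1 - t)⁻¹) ^ 5 * s ^ 2 else 0)
      ≤ ENNReal.ofReal (h ^ 2) := by
  -- The two constraints `t ≤ 1/2` and `s ≤ (1 - t) h` together say `t ≤ 1 - m`.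
  set m := max (1 / 2) (s / h) with hm
  have hm2 : 1 / 2 ≤ m := le_max_left _ _
  have hsm : s ≤ m * h := (div_le_iff₀ hh).1 (le_max_right _ _)
  have hsub : ∀ t ∈ Set.Ioc (0 : ℝ) (1 / 2),
      ENNReal.ofReal (if s ≤ (1 - t) * h then ((1 - t)⁻¹) ^ 5 * s ^ 2 else 0) ≤
      (Set.Ioc 0 (1 - m)).indicator (fun t => ENNReal.ofReal (((1 - t)⁻¹) ^ 5 * s ^ 2)) t := by
    intro t ht
    split_ifs with hc
    · rw [Set.indicator_of_mem]
      refine ⟨ht.1, ?_⟩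
      have : m ≤ 1 - t := max_le (by linarith [ht.2]) ((div_le_iff₀ hh).2 hc)
      linarith
    · simp
  refine (setLIntegral_mono' measurableSet_Ioc hsub).trans ?_
  refine (setLIntegral_le_lintegral _ _).trans ?_
  rw [lintegral_indicator measurableSet_Ioc]
  rcases le_or_gt (1 - m) 0 with hneg | hpos
  · rw [Set.Ioc_eq_empty (not_lt.2 hneg)]
    simp
  have hder : ∀ t ∈ Set.uIcc 0 (1 - m),
      HasDerivAt (fun t : ℝ => ((1 - t)⁻¹) ^ 4 / 4 * s ^ 2) (((1 - t)⁻¹) ^ 5 * s ^ 2) t := by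
    intro t ht
    rw [Set.uIcc_of_le hpos.le] at ht
    have h0 : (1 - t) ≠ 0 := by have := ht.2; linarith
    have h1 : HasDerivAt (fun t : ℝ => 1 - t) (-1) t := (hasDerivAt_id t).const_sub 1
    refine ((((h1.inv h0).pow 4).div_const 4).mul_const (s ^ 2)).congr_deriv ?_
    simp only [Pi.inv_apply]
    field_simp
    norm_num
    left
    field_simp
  have hcont : ContinuousOn (fun t : ℝ => ((1 - t)⁻¹) ^ 5 * s ^ 2) (Set.uIcc 0 (1 - m)) := by
    refine ContinuousOn.mul (ContinuousOn.pow (ContinuousOn.inv₀ (by fun_prop) ?_) _)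
      continuousOn_const
    intro t ht
    rw [Set.uIcc_of_le hpos.le] at ht
    have := ht.2
    linarith
  have hftc := intervalIntegral.integral_eq_sub_of_hasDerivAt hder hcont.intervalIntegrable
  rw [intervalIntegral.integral_of_le hpos.le] at hftc
  rw [← ofReal_integral_eq_lintegral_ofReal, hftc]
  · refine ENNReal.ofReal_le_ofReal ?_
    have hmpos : 0 < m := by linarith
    -- The integral is `(m⁻⁴ - 1) s² / 4`. With `s ≤ m h` this is at most `m⁻² h² / 4`, and `m ≥
    -- 1/2` makes it at most `h²`: the constant is exactly one.
    have h4 : s ^ 2 ≤ m ^ 2 * h ^ 2 := by rw [← mul_pow]; exact pow_le_pow_left₀ hs hsm 2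
    have h5 : (m⁻¹) ^ 4 / 4 * s ^ 2 ≤ (m⁻¹) ^ 4 / 4 * (m ^ 2 * h ^ 2) := by gcongr
    have h6 : (m⁻¹) ^ 4 / 4 * (m ^ 2 * h ^ 2) = (m⁻¹) ^ 2 / 4 * h ^ 2 := by field_simp
    have h7 : m⁻¹ ≤ 2 := by
      rw [inv_le_comm₀ hmpos (by norm_num)]; linarith
    have h8 : (m⁻¹) ^ 2 ≤ 4 := by
      have := pow_le_pow_left₀ (inv_nonneg.2 hmpos.le) h7 2; linarith
    have h9 : (m⁻¹) ^ 2 / 4 * h ^ 2 ≤ 1 * h ^ 2 := by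
      have : (m⁻¹) ^ 2 / 4 ≤ 1 := by linarith
      gcongr
    have : 0 ≤ s ^ 2 := sq_nonneg s
    rw [sub_sub_cancel, sub_zero]
    norm_num only [inv_one, one_pow]
    linarith
  · rw [Set.uIcc_of_le hpos.le] at hcont
    exact (hcont.integrableOn_Icc).mono_set Set.Ioc_subset_Icc_self
  · filter_upwards [ae_restrict_mem measurableSet_Ioc] with t ht
    have : 0 ≤ 1 - t := by linarith [ht.2]
    exact mul_nonneg (pow_nonneg (inv_nonneg.2 this) _) (sq_nonneg s)

theorem lintegral_comp_homothety (f : RVec n → ENNReal) (hf : Measurable f) {a : ℝ} (ha : 0 < a)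
    (y : RVec n) :
    ∫⁻ x, f (a • x + y) = ENNReal.ofReal ((a⁻¹) ^ n) * ∫⁻ z, f z := by
  have h1 : ∫⁻ x, f (a • x + y) = ∫⁻ z, f (z + y) ∂(Measure.map (fun x : RVec n => a • x) volume) := by
    rw [lintegral_map (f := fun z => f (z + y)) (hf.comp (measurable_id.add_const y))
      (measurable_const_smul a)]
  rw [h1, Measure.map_addHaar_smul _ ha.ne', lintegral_smul_measure, lintegral_add_right_eq_self]
  simp [abs_of_pos ha]

theorem lintegral_lintegral_lintegral_rotate {α β γ : Type*} [MeasurableSpace α]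
    [MeasurableSpace β] [MeasurableSpace γ] {μ : Measure α} {ν : Measure β} {τ : Measure γ}
    [SFinite μ] [SFinite ν] [SFinite τ] {f : α → β → γ → ENNReal}
    (hf : Measurable fun p : α × β × γ => f p.1 p.2.1 p.2.2) :
    ∫⁻ x, ∫⁻ y, ∫⁻ t, f x y t ∂τ ∂ν ∂μ = ∫⁻ t, ∫⁻ x, ∫⁻ y, f x y t ∂ν ∂μ ∂τ := by
  symm
  rw [lintegral_lintegral_swap]
  · refine lintegral_congr fun x => ?_
    symm
    refine lintegral_lintegral_swap (Measurable.aemeasurable ?_)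
    exact hf.comp measurable_prodMk_left
  · refine (Measurable.lintegral_prod_right' (f := fun q : (γ × α) × β => f q.1.2 q.2 q.1.1)
      ?_).aemeasurable
    exact hf.comp (f := fun q : (γ × α) × β => (q.1.2, q.2, q.1.1)) (by fun_prop)

/-- Averages over segments of a function on a convex set. -/
theorem lintegral_segment_average_le (hn : n ≤ 3) {K : Set (RVec n)} (hK : Convex ℝ K)
    (hKb : Bornology.IsBounded K) (hKm : MeasurableSet K) (hd : 0 < Metric.diam K)
    {g : RVec n → ℝ} (hg : Measurable g) :
    ∫⁻ t in Set.Ioc (0 : ℝ) (1 / 2), ∫⁻ y in K, ∫⁻ x in K,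
      ENNReal.ofReal (‖x - y‖ ^ 2 * g ((1 - t) • x + t • y)) ≤
    ENNReal.ofReal (Metric.diam K ^ 2) * volume K * ∫⁻ z in K, ENNReal.ofReal (g z) := by
  set h := Metric.diam K with hh
  -- Substituting `z = (1 - t) x + t y` gives `‖x - y‖ = ‖z - y‖ / (1 - t)` and the Jacobian `(1 -
  -- t)⁻ⁿ`; the condition `‖x - y‖ ≤ h` becomes the one in the `if`. The exponent 5 is the value of
  -- `n + 2` for `n = 3`.
  let κ : ℝ → RVec n → RVec n → ENNReal := fun t y z =>
    ENNReal.ofReal (if ‖z - y‖ ≤ (1 - t) * h then ((1 - t)⁻¹) ^ 5 * ‖z - y‖ ^ 2 else 0) *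
      ENNReal.ofReal (g z)
  have hκ : Measurable fun p : RVec n × RVec n × ℝ => κ p.2.2 p.1 p.2.1 := by
    refine Measurable.mul (Measurable.ennreal_ofReal (Measurable.ite ?_ ?_ measurable_const))
      (Measurable.ennreal_ofReal (hg.comp (by fun_prop)))
    · exact measurableSet_le (by fun_prop) (by fun_prop)
    · fun_prop
  have slice : ∀ t ∈ Set.Ioc (0 : ℝ) (1 / 2), ∀ y ∈ K,
      ∫⁻ x in K, ENNReal.ofReal (‖x - y‖ ^ 2 * g ((1 - t) • x + t • y)) ≤
        ∫⁻ z in K, κ t y z := by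
    intro t ht y hy
    have ht1 : 0 < 1 - t := by linarith [ht.2]
    have hone : 1 ≤ (1 - t)⁻¹ := (one_le_inv₀ ht1).2 (by linarith [ht.1])
    -- The integrand in the variable `z`, before the Jacobian; the indicator is harmless because `z`
    -- stays in `K` by convexity.
    let Φ : RVec n → ENNReal := K.indicator fun z =>
      ENNReal.ofReal (if ‖z - y‖ ≤ (1 - t) * h then ((1 - t)⁻¹) ^ 2 * ‖z - y‖ ^ 2 else 0) *
        ENNReal.ofReal (g z)
    have hΦ : Measurable Φ := by
      refine Measurable.indicator (Measurable.mul (Measurable.ennreal_ofReal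
        (Measurable.ite ?_ ?_ measurable_const)) (Measurable.ennreal_ofReal hg)) hKm
      · exact measurableSet_le (by fun_prop) (by fun_prop)
      · fun_prop
    have h1 : ∫⁻ x in K, ENNReal.ofReal (‖x - y‖ ^ 2 * g ((1 - t) • x + t • y)) ≤
        ∫⁻ x, Φ ((1 - t) • x + t • y) := by
      refine le_trans (setLIntegral_mono' hKm fun x hx => ?_) (setLIntegral_le_lintegral K _)
      have hz : (1 - t) • x + t • y ∈ K := hK hx hy ht1.le ht.1.le (by ring)
      have e : (1 - t) • x + t • y - y = (1 - t) • (x - y) := by module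
      have hn' : ‖(1 - t) • x + t • y - y‖ = (1 - t) * ‖x - y‖ := by
        rw [e, norm_smul, Real.norm_of_nonneg ht1.le]
      have hxy : ‖x - y‖ ≤ h := by
        rw [← dist_eq_norm]; exact Metric.dist_le_diam_of_mem hKb hx hy
      simp only [Φ]
      rw [Set.indicator_of_mem hz, hn', if_pos (by gcongr), ← ENNReal.ofReal_mul (by positivity)]
      refine ENNReal.ofReal_le_ofReal (le_of_eq ?_)
      field_simp
    refine h1.trans ?_
    rw [lintegral_comp_homothety Φ hΦ ht1, lintegral_indicator hKm,
      ← lintegral_const_mul' _ _ ENNReal.ofReal_ne_top]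
    refine lintegral_mono fun z => ?_
    simp only [κ]
    rw [← mul_assoc, ← ENNReal.ofReal_mul (by positivity)]
    gcongr
    -- The Jacobian and the rescaled length combine to the power `n + 2 ≤ 5` of `(1 - t)⁻¹ ≥ 1`.
    split_ifs
    · rw [← mul_assoc, ← pow_add]
      gcongr
      omega
    · simp
  calc _ ≤ ∫⁻ t in Set.Ioc (0 : ℝ) (1 / 2), ∫⁻ y in K, ∫⁻ z in K, κ t y z :=
        setLIntegral_mono' measurableSet_Ioc fun t ht =>
          setLIntegral_mono' hKm fun y hy => slice t ht y hy
    _ = ∫⁻ y in K, ∫⁻ z in K, ∫⁻ t in Set.Ioc (0 : ℝ) (1 / 2), κ t y z :=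
        (lintegral_lintegral_lintegral_rotate (f := fun y z t => κ t y z) hκ).symm
    _ ≤ ∫⁻ _ in K, ∫⁻ z in K, ENNReal.ofReal (h ^ 2) * ENNReal.ofReal (g z) := by
        refine lintegral_mono fun y => lintegral_mono fun z => ?_
        simp only [κ]
        rw [lintegral_mul_const' _ _ ENNReal.ofReal_ne_top]
        gcongr
        exact lintegral_kernel_le (norm_nonneg _) hd
    _ = _ := by
        rw [lintegral_const, Measure.restrict_apply_univ,
          lintegral_const_mul' _ _ ENNReal.ofReal_ne_top]
        ring

/-- Exchanging `x` and `y` reflects `t` to `1 - t`, so the halves `t ≤ 1/2` and `t ≥ 1/2` contribute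
equally, whence the factor 2. On the first half `1 - t` stays away from zero, which makes the
substitution for `x` harmless. -/
theorem lintegral_lintegral_norm_sub_sq_le (hn : n ≤ 3) {K : Set (RVec n)} (hK : Convex ℝ K)
    (hKb : Bornology.IsBounded K) (hKm : MeasurableSet K) (hd : 0 < Metric.diam K)
    {φ : RVec n → ℂ} (h : ContDiff ℝ ∞ φ) :
    ∫⁻ y in K, ∫⁻ x in K, ENNReal.ofReal (‖φ x - φ y‖ ^ 2) ≤
      2 * (ENNReal.ofReal (Metric.diam K ^ 2) * volume K *
        ∫⁻ z in K, ENNReal.ofReal (‖cgrad φ z‖ ^ 2)) := by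
  have hcg := continuous_cgrad h
  let ψ : RVec n → RVec n → ℝ → ENNReal := fun y x t =>
    ENNReal.ofReal (‖x - y‖ ^ 2 * ‖cgrad φ ((1 - t) • x + t • y)‖ ^ 2)
  have hψ : Measurable fun p : RVec n × RVec n × ℝ => ψ p.1 p.2.1 p.2.2 :=
    Measurable.ennreal_ofReal (Continuous.measurable (by fun_prop))
  let H : ℝ → ENNReal := fun t => ∫⁻ y in K, ∫⁻ x in K, ψ y x t
  have hsymm : ∀ t, H (1 - t) = H t := by
    intro t
    simp only [H]
    rw [lintegral_lintegral_swap]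
    · refine lintegral_congr fun x => lintegral_congr fun y => ?_
      simp only [ψ]
      rw [norm_sub_rev, sub_sub_cancel, add_comm]
    · exact (hψ.comp (f := fun p : RVec n × RVec n => (p.1, p.2, 1 - t)) (by fun_prop)).aemeasurable
  have hHhalf := lintegral_segment_average_le hn hK hKb hKm hd
    (g := fun z => ‖cgrad φ z‖ ^ 2) (by fun_prop)
  have hrefl : ∫⁻ t in Set.Ioc (1 / 2 : ℝ) 1, H t = ∫⁻ t in Set.Ioc (0 : ℝ) (1 / 2), H t := by
    have hmp := Measure.measurePreserving_sub_left (volume : Measure ℝ) 1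
    have hpre : (fun t : ℝ => 1 - t) ⁻¹' Set.Ioc (1 / 2 : ℝ) 1 = Set.Ico 0 (1 / 2) := by
      ext t
      simp only [Set.mem_preimage, Set.mem_Ioc, Set.mem_Ico]
      constructor <;> rintro ⟨h1, h2⟩ <;> constructor <;> linarith
    have e := hmp.setLIntegral_comp_preimage_emb
      (MeasurableEquiv.subLeft (1 : ℝ)).measurableEmbedding H (Set.Ioc (1 / 2 : ℝ) 1)
    rw [← e, hpre]
    simp only [hsymm]
    exact setLIntegral_congr Ico_ae_eq_Ioc
  calc _ ≤ ∫⁻ y in K, ∫⁻ x in K, ∫⁻ t in Set.Ioc (0 : ℝ) 1, ψ y x t :=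
        lintegral_mono fun y => lintegral_mono fun x => norm_sub_sq_le_segment h x y
    _ = ∫⁻ t in Set.Ioc (0 : ℝ) 1, H t := lintegral_lintegral_lintegral_rotate hψ
    _ = (∫⁻ t in Set.Ioc (0 : ℝ) (1 / 2), H t) + ∫⁻ t in Set.Ioc (1 / 2 : ℝ) 1, H t := by
        rw [← Set.Ioc_union_Ioc_eq_Ioc (b := (1 / 2 : ℝ)) (by norm_num) (by norm_num),
          lintegral_union measurableSet_Ioc (Set.Ioc_disjoint_Ioc_of_le le_rfl)]
    _ ≤ _ := by
        rw [hrefl, ← two_mul]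
        gcongr

/-- Used twice in the Poincaré inequality: with `a = φ y` in the double integral, and with `a` the
mean of `φ`. -/
theorem integral_norm_sub_const_sq {K : Set (RVec n)} {f : RVec n → ℂ}
    (hf : IntegrableOn f K) (hf2 : IntegrableOn (fun x => ‖f x‖ ^ 2) K) (hK : volume K ≠ ⊤)
    (a : ℂ) :
    IntegrableOn (fun x => ‖f x - a‖ ^ 2) K ∧
    ∫ x in K, ‖f x - a‖ ^ 2 = (∫ x in K, ‖f x‖ ^ 2) - 2 * (conj a * ∫ x in K, f x).re
      + volume.real K * ‖a‖ ^ 2 := by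
  have e : ∀ x, ‖f x - a‖ ^ 2 = ‖f x‖ ^ 2 - 2 * (conj a * f x).re + ‖a‖ ^ 2 := fun x => by
    simp only [← Complex.normSq_eq_norm_sq, Complex.normSq_apply, Complex.mul_re, Complex.conj_re,
      Complex.conj_im, Complex.sub_re, Complex.sub_im]
    ring
  have i1 : IntegrableOn (fun x => 2 * (conj a * f x).re) K :=
    ((hf.const_mul (conj a)).re).const_mul 2
  have i2 : IntegrableOn (fun _ : RVec n => ‖a‖ ^ 2) K := integrableOn_const hK
  have e2 : ∫ x in K, 2 * (conj a * f x).re = 2 * (conj a * ∫ x in K, f x).re := by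
    have := integral_re (hf.const_mul (conj a))
    rw [integral_const_mul] at this
    rw [integral_const_mul]
    exact congrArg (2 * ·) this
  have i3 : IntegrableOn (fun x => ‖f x‖ ^ 2 - 2 * (conj a * f x).re) K := hf2.sub i1
  simp only [e]
  refine ⟨i3.add i2, ?_⟩
  rw [integral_add i3 i2, integral_sub hf2 i1, e2, setIntegral_const, smul_eq_mul]

/-- Poincaré inequality on convex sets of dimension at most three, with constant the diameter. -/
theorem integral_norm_sub_mean_sq_le (hn : n ≤ 3) {K : Set (RVec n)} (hK : Convex ℝ K)
    (hKb : Bornology.IsBounded K) (hKm : MeasurableSet K) (hd : 0 < Metric.diam K)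
    (hv : 0 < volume.real K) {φ : RVec n → ℂ} (h : ContDiff ℝ ∞ φ) :
    ∫ x in K, ‖φ x - (volume.real K : ℂ)⁻¹ * ∫ y in K, φ y‖ ^ 2 ≤
      Metric.diam K ^ 2 * ∫ x in K, ‖cgrad φ x‖ ^ 2 := by
  have hcg := continuous_cgrad h
  have hφ := h.continuous
  have key : ∀ {E : Type} [NormedAddCommGroup E] {g : RVec n → E}, Continuous g →
      IntegrableOn g K := fun hg =>
    (hg.continuousOn.integrableOn_compact hKb.isCompact_closure).mono_set subset_closure
  have hfin : volume K ≠ ⊤ := hKb.measure_lt_top.ne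
  set V := volume.real K with hV
  set S := ∫ x in K, ‖φ x‖ ^ 2 with hS
  set I := ∫ x in K, φ x with hI
  have hvar := fun a => integral_norm_sub_const_sq (key hφ) (key (by fun_prop)) hfin a
  have iG : IntegrableOn (fun x => ‖cgrad φ x‖ ^ 2) K := key (by fun_prop)
  have hJ : ∀ y, ∫ x in K, ‖φ x - φ y‖ ^ 2 = S - 2 * (conj (φ y) * I).re + V * ‖φ y‖ ^ 2 :=
    fun y => (hvar (φ y)).2
  have iJ : IntegrableOn (fun y => S - 2 * (conj (φ y) * I).re + V * ‖φ y‖ ^ 2) K :=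
    key (by
      have : Continuous fun y => conj (φ y) := Complex.continuous_conj.comp hφ
      fun_prop)
  have hdouble := lintegral_lintegral_norm_sub_sq_le hn hK hKb hKm hd h
  have e1 : ∫⁻ y in K, ∫⁻ x in K, ENNReal.ofReal (‖φ x - φ y‖ ^ 2) =
      ENNReal.ofReal (∫ y in K, (S - 2 * (conj (φ y) * I).re + V * ‖φ y‖ ^ 2)) := by
    rw [ofReal_integral_eq_lintegral_ofReal iJ (Eventually.of_forall fun y => ?_)]
    · refine lintegral_congr fun y => ?_
      rw [← hJ, ofReal_integral_eq_lintegral_ofReal (hvar (φ y)).1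
        (Eventually.of_forall fun x => sq_nonneg _)]
    · change 0 ≤ S - 2 * (conj (φ y) * I).re + V * ‖φ y‖ ^ 2
      rw [← hJ]
      exact integral_nonneg fun x => sq_nonneg _
  -- The double integral of `‖φ x - φ y‖²` is `2V` times the squared deviation from the mean, `S -
  -- ‖I‖² / V`.
  have e2 : ∫ y in K, (S - 2 * (conj (φ y) * I).re + V * ‖φ y‖ ^ 2) =
      2 * (V * S - ‖I‖ ^ 2) := by
    have i0 : IntegrableOn (fun _ : RVec n => S) K := integrableOn_const hfin
    have i1' : IntegrableOn (fun y => conj (φ y) * I) K :=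
      key ((Complex.continuous_conj.comp hφ).mul continuous_const)
    have i1 : IntegrableOn (fun y => 2 * (conj (φ y) * I).re) K := i1'.re.const_mul 2
    have i2 : IntegrableOn (fun y => V * ‖φ y‖ ^ 2) K := key (by fun_prop)
    have e3 : ∫ y in K, 2 * (conj (φ y) * I).re = 2 * ‖I‖ ^ 2 := by
      rw [integral_const_mul]
      congr 1
      have := integral_re i1'
      rw [integral_mul_const, integral_conj, ← hI] at this
      refine this.trans ?_
      rw [← Complex.normSq_eq_conj_mul_self, ← Complex.normSq_eq_norm_sq]
      exact Complex.ofReal_re _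
    have i3 : IntegrableOn (fun y => S - 2 * (conj (φ y) * I).re) K := i0.sub i1
    rw [integral_add i3 i2, integral_sub i0 i1, e3, setIntegral_const,
      integral_const_mul, smul_eq_mul]
    ring
  have e4 : (2 : ENNReal) * (ENNReal.ofReal (Metric.diam K ^ 2) * volume K *
      ∫⁻ z in K, ENNReal.ofReal (‖cgrad φ z‖ ^ 2)) =
      ENNReal.ofReal (2 * (Metric.diam K ^ 2 * V * ∫ z in K, ‖cgrad φ z‖ ^ 2)) := by
    rw [← ofReal_integral_eq_lintegral_ofReal iG (Eventually.of_forall fun x => sq_nonneg _),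
      ENNReal.ofReal_mul (by norm_num), ENNReal.ofReal_mul (by positivity),
      ENNReal.ofReal_mul (by positivity), hV, Measure.real, ENNReal.ofReal_toReal hfin]
    simp
  rw [e1, e2, e4, ENNReal.ofReal_le_ofReal_iff (by
    have := integral_nonneg (μ := volume.restrict K) (f := fun x => ‖cgrad φ x‖ ^ 2)
      fun x => sq_nonneg _
    positivity)] at hdouble
  rw [(hvar _).2]
  have e5 : (conj ((V : ℂ)⁻¹ * I) * I).re = V⁻¹ * ‖I‖ ^ 2 := by
    rw [map_mul, mul_assoc, ← Complex.normSq_eq_conj_mul_self, ← Complex.normSq_eq_norm_sq,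
      ← Complex.ofReal_inv, Complex.conj_ofReal, ← Complex.ofReal_mul, Complex.ofReal_re]
  have e6 : V * ‖(V : ℂ)⁻¹ * I‖ ^ 2 = V⁻¹ * ‖I‖ ^ 2 := by
    rw [norm_mul, norm_inv, Complex.norm_real, Real.norm_of_nonneg hv.le]
    field_simp
  rw [e5, e6]
  refine le_of_mul_le_mul_left ?_ hv
  have : V * (V⁻¹ * ‖I‖ ^ 2) = ‖I‖ ^ 2 := by field_simp
  nlinarith [hdouble, this]

end Poincare

/-! ### Square roots of matrix weights -/

section MatrixWeight

variable {n : ℕ}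

/-- The continuous linear map of `ℂⁿ` given by a real matrix. -/
def realCLM (W : Matrix (Fin n) (Fin n) ℝ) : CVec n →L[ℂ] CVec n :=
  Matrix.toEuclideanCLM (𝕜 := ℂ) (W.map Complex.ofReal)

theorem realCLM_apply (W : Matrix (Fin n) (Fin n) ℝ) (v : CVec n) (i : Fin n) :
    realCLM W v i = ∑ j, (W i j : ℂ) * v j := by
  rw [realCLM, Matrix.ofLp_toEuclideanCLM]
  rfl

theorem realCLM_mul (V W : Matrix (Fin n) (Fin n) ℝ) (v : CVec n) :
    realCLM (V * W) v = realCLM V (realCLM W v) := by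
  have : (V * W).map Complex.ofReal = V.map Complex.ofReal * W.map Complex.ofReal :=
    Matrix.map_mul (f := Complex.ofRealHom)
  rw [realCLM, this, map_mul]
  rfl

theorem realCLM_one (v : CVec n) : realCLM (1 : Matrix (Fin n) (Fin n) ℝ) v = v := by
  have : (1 : Matrix (Fin n) (Fin n) ℝ).map Complex.ofReal = 1 :=
    Matrix.map_one _ Complex.ofReal_zero Complex.ofReal_one
  rw [realCLM, this, map_one]
  rfl

theorem inner_realCLM_conjTranspose (B : Matrix (Fin n) (Fin n) ℝ) (v w : CVec n) :
    inner ℂ (realCLM B.conjTranspose v) w = inner ℂ v (realCLM B w) := by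
  have h : realCLM B.conjTranspose = ContinuousLinearMap.adjoint (realCLM B) := by
    have : (B.conjTranspose).map Complex.ofReal = star (B.map Complex.ofReal) := by
      ext i j
      simp [Matrix.star_apply]
    rw [realCLM, this, map_star]
    rfl
  rw [h, ContinuousLinearMap.adjoint_inner_left]

theorem re_inner_realCLM (W : Matrix (Fin n) (Fin n) ℝ) (v : CVec n) :
    (∑ i, (∑ j, (W i j : ℂ) * v j) * conj (v i)).re = (inner ℂ v (realCLM W v)).re := by
  rw [PiLp.inner_apply]
  simp only [RCLike.inner_apply, realCLM_apply]

open scoped MatrixOrder in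
theorem exists_conjTranspose_mul_self {W : Matrix (Fin n) (Fin n) ℝ} (hW : W.PosSemidef) :
    ∃ B : Matrix (Fin n) (Fin n) ℝ, B.conjTranspose * B = W := by
  obtain ⟨X, hX, -, e⟩ := CFC.exists_sqrt_of_isSelfAdjoint_of_quasispectrumRestricts hW.isHermitian
    (QuasispectrumRestricts.nnreal_of_nonneg hW.nonneg)
  refine ⟨X, ?_⟩
  have : X.conjTranspose = X := hX.star_eq
  rw [this, e]

open Classical in
/-- A matrix `B` with `Bᵀ B = W` if `W` is positive semidefinite (zero otherwise). -/
def matrixRoot (W : Matrix (Fin n) (Fin n) ℝ) : Matrix (Fin n) (Fin n) ℝ :=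
  if hW : W.PosSemidef then (exists_conjTranspose_mul_self hW).choose else 0

theorem matrixRoot_spec {W : Matrix (Fin n) (Fin n) ℝ} (hW : W.PosSemidef) :
    (matrixRoot W).conjTranspose * matrixRoot W = W := by
  rw [matrixRoot, dif_pos hW]
  exact (exists_conjTranspose_mul_self hW).choose_spec

theorem inner_matrixRoot {W : Matrix (Fin n) (Fin n) ℝ} (hW : W.PosSemidef) (v w : CVec n) :
    inner ℂ (realCLM (matrixRoot W) v) (realCLM (matrixRoot W) w) = inner ℂ v (realCLM W w) := by
  conv_rhs => rw [← matrixRoot_spec hW, realCLM_mul]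
  rw [← inner_conj_symm, ← inner_realCLM_conjTranspose, inner_conj_symm]

/-- The smallest eigenvalue of a positive definite matrix is positive. -/
theorem sInf_spectrum_pos (hn : 0 < n) {W : Matrix (Fin n) (Fin n) ℝ} (hW : W.PosDef) :
    0 < sInf (spectrum ℝ W) := by
  have : Nonempty (Fin n) := ⟨⟨0, hn⟩⟩
  rw [hW.1.spectrum_real_eq_range_eigenvalues]
  obtain ⟨i, hi⟩ := (Set.range_nonempty hW.1.eigenvalues).csInf_mem (Set.finite_range _)
  rw [← hi]
  exact hW.eigenvalues_pos i

/-- Subtracting a multiple of the identity translates the spectrum, so no eigenvalue becomes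
negative. -/
theorem posSemidef_sub_sInf_spectrum {W : Matrix (Fin n) (Fin n) ℝ} (hW : W.IsHermitian) :
    (W - algebraMap ℝ _ (sInf (spectrum ℝ W))).PosSemidef := by
  set a := sInf (spectrum ℝ W) with ha
  have hH : (W - algebraMap ℝ _ a).IsHermitian := by
    refine hW.sub ?_
    rw [Matrix.algebraMap_eq_diagonal]
    exact Matrix.isHermitian_diagonal _
  rw [hH.posSemidef_iff_eigenvalues_nonneg]
  intro i
  have h1 := hH.eigenvalues_mem_spectrum_real i
  rw [← spectrum.sub_singleton_eq] at h1
  obtain ⟨l, hl, b, rfl, e⟩ := h1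
  have h2 : a ≤ l := csInf_le W.finite_real_spectrum.bddBelow hl
  change (0 : ℝ) ≤ _
  rw [← e]
  exact sub_nonneg.2 h2

/-- The difference of the two sides is a square: it is the quadratic form of `W - a`, which has a
root of its own. -/
theorem sInf_spectrum_mul_norm_sq_le {W : Matrix (Fin n) (Fin n) ℝ} (hW : W.PosSemidef)
    (v : CVec n) :
    sInf (spectrum ℝ W) * ‖v‖ ^ 2 ≤ ‖realCLM (matrixRoot W) v‖ ^ 2 := by
  set a := sInf (spectrum ℝ W) with ha
  have h := posSemidef_sub_sInf_spectrum hW.1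
  rw [← ha] at h
  have e : ‖realCLM (matrixRoot W) v‖ ^ 2 - a * ‖v‖ ^ 2 =
      ‖realCLM (matrixRoot (W - algebraMap ℝ _ a)) v‖ ^ 2 := by
    have key : ∀ {V : Matrix (Fin n) (Fin n) ℝ}, V.PosSemidef →
        ‖realCLM (matrixRoot V) v‖ ^ 2 = (inner ℂ v (realCLM V v)).re := fun hV => by
      rw [← inner_matrixRoot hV, ← inner_self_eq_norm_sq (𝕜 := ℂ)]
      rfl
    have e1 : realCLM (W - algebraMap ℝ _ a) v = realCLM W v - (a : ℂ) • v := by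
      ext i
      simp [realCLM_apply, sub_mul, Finset.sum_sub_distrib, Matrix.algebraMap_eq_diagonal,
        Matrix.diagonal_apply, apply_ite Complex.ofReal]
    rw [key hW, key h, e1, inner_sub_right, inner_smul_right, Complex.sub_re,
      Complex.re_ofReal_mul]
    congr 2
    exact (inner_self_eq_norm_sq (𝕜 := ℂ) v).symm
  nlinarith [sq_nonneg ‖realCLM (matrixRoot (W - algebraMap ℝ _ a)) v‖, e]

end MatrixWeight

/-! ### Multiplication by piecewise constant functions -/

section Multiplication

variable {n : ℕ} {G : Domain n} {M : Mesh G}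

/-- Justifies reading the value of a piecewise constant function at the barycentre, and shows that
elements are nonempty. -/
theorem centroid_mem_elem (M : Mesh G) {K : Finset (RVec n)} (hK : K ∈ M.elems) :
    K.centroid ℝ id ∈ elem K := by
  have hspan : affineSpan ℝ (Set.range ((↑) : K → RVec n)) = ⊤ := by
    rw [(M.affineIndep K hK).affineSpan_eq_top_iff_card_eq_finrank_add_one]
    simp [M.card_eq K hK]
  let b : AffineBasis K ℝ (RVec n) := ⟨(↑), M.affineIndep K hK, hspan⟩
  have h := b.centroid_mem_interior_convexHull
  have e1 : Finset.centroid ℝ Finset.univ ⇑b = K.centroid ℝ id := Finset.centroid_univ ℝ K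
  have e2 : Set.range ⇑b = (K : Set (RVec n)) := Subtype.range_coe
  rw [e1, e2] at h
  exact h

theorem Mesh.ae_of_forall_elem (M : Mesh G) {P : RVec n → Prop}
    (h : ∀ K ∈ M.elems, ∀ x ∈ elem K, P x) : ∀ᵐ x ∂(volume.restrict G.Ω), P x := by
  filter_upwards [M.ae_exists_elem] with x hx
  obtain ⟨K, hK, hxK⟩ := hx
  exact h K hK x hxK

theorem Mesh.IsPwConst.comp {X Y : Type*} {f : RVec n → X} (hf : M.IsPwConst f) (g : X → Y) :
    M.IsPwConst fun x => g (f x) :=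
  fun K hK x hx y hy => congrArg g (hf K hK x hx y hy)

/-- Nothing is assumed on the faces, but these form a null set; elsewhere `f` is a finite sum of
indicators. -/
theorem Mesh.IsPwConst.aestronglyMeasurable {E : Type*} [NormedAddCommGroup E] {f : RVec n → E}
    (hf : M.IsPwConst f) : AEStronglyMeasurable f (volume.restrict G.Ω) := by
  refine ⟨fun x => ∑ K ∈ M.elems, (elem K).indicator (fun _ => f (K.centroid ℝ id)) x,
    Finset.stronglyMeasurable_fun_sum _ fun K _ =>
      stronglyMeasurable_const.indicator isOpen_interior.measurableSet, ?_⟩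
  refine M.ae_of_forall_elem fun K hK x hx => ?_
  change f x = ∑ K ∈ M.elems, (elem K).indicator (fun _ => f (K.centroid ℝ id)) x
  rw [Finset.sum_eq_single_of_mem K hK, Set.indicator_of_mem hx]
  · exact hf K hK x hx _ (centroid_mem_elem M hK)
  · intro K' hK' hne
    exact Set.indicator_of_notMem (fun h => hne (M.elem_disjoint K' hK' K hK x h hx)) _

theorem Mesh.IsPwConst.ae_norm_le {E : Type*} [NormedAddCommGroup E] {f : RVec n → E}
    (hf : M.IsPwConst f) : ∃ C : ℝ, 0 ≤ C ∧ ∀ᵐ x ∂(volume.restrict G.Ω), ‖f x‖ ≤ C := by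
  refine ⟨∑ K ∈ M.elems, ‖f (K.centroid ℝ id)‖, Finset.sum_nonneg fun _ _ => norm_nonneg _, ?_⟩
  refine M.ae_of_forall_elem fun K hK x hx => ?_
  rw [hf K hK x hx _ (centroid_mem_elem M hK)]
  exact Finset.single_le_sum (f := fun K => ‖f (K.centroid ℝ id)‖)
    (fun _ _ => norm_nonneg _) hK

variable {E E' : Type*} [NormedAddCommGroup E] [InnerProductSpace ℂ E]
  [NormedAddCommGroup E'] [InnerProductSpace ℂ E']

theorem Mesh.IsPwConst.memLp_apply {f : RVec n → E →L[ℂ] E'} (hf : M.IsPwConst f)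
    (v : Lp E 2 (volume.restrict G.Ω)) :
    MemLp (fun x => f x (v x)) 2 (volume.restrict G.Ω) := by
  obtain ⟨C, -, hC⟩ := hf.ae_norm_le
  refine (Lp.memLp v).of_le_mul (c := C) ?_ ?_
  · exact ContinuousLinearMap.aestronglyMeasurable_comp₂ (ContinuousLinearMap.id ℂ (E →L[ℂ] E'))
      hf.aestronglyMeasurable (Lp.aestronglyMeasurable v)
  · filter_upwards [hC] with x hx
    exact (f x).le_of_opNorm_le hx _

/-- The operator on `L²(Ω)` of multiplication by a piecewise constant function. -/
def mulOp {f : RVec n → E →L[ℂ] E'} (hf : M.IsPwConst f) :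
    Lp E 2 (volume.restrict G.Ω) →L[ℂ] Lp E' 2 (volume.restrict G.Ω) :=
  LinearMap.mkContinuousOfExistsBound
    { toFun := fun v => (hf.memLp_apply v).toLp _
      map_add' := fun v w => by
        rw [← MemLp.toLp_add]
        refine MemLp.toLp_congr _ _ ?_
        filter_upwards [Lp.coeFn_add v w] with x hx
        rw [hx, Pi.add_apply, map_add, Pi.add_apply]
      map_smul' := fun a v => by
        rw [RingHom.id_apply, ← MemLp.toLp_const_smul]
        refine MemLp.toLp_congr _ _ ?_
        filter_upwards [Lp.coeFn_smul a v] with x hx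
        rw [hx, Pi.smul_apply, map_smul, Pi.smul_apply] } (by
    obtain ⟨C, hC0, hC⟩ := hf.ae_norm_le
    refine ⟨C, fun v => Lp.norm_le_mul_norm_of_ae_le_mul ?_⟩
    filter_upwards [hC, (hf.memLp_apply v).coeFn_toLp] with x hx h1
    simp only [LinearMap.coe_mk, AddHom.coe_mk]
    rw [h1]
    exact (f x).le_of_opNorm_le hx _)

theorem mulOp_ae {f : RVec n → E →L[ℂ] E'} (hf : M.IsPwConst f)
    (v : Lp E 2 (volume.restrict G.Ω)) :
    ∀ᵐ x ∂(volume.restrict G.Ω), mulOp hf v x = f x (v x) :=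
  (hf.memLp_apply v).coeFn_toLp

/-- Adjoints of multiplication operators are taken pointwise. As `inner` is antilinear in its first
argument, `(f, g)_Ω` is `inner ℂ g f`. -/
theorem inner_mulOp {f : RVec n → E →L[ℂ] E'} (hf : M.IsPwConst f) {g : RVec n → E' →L[ℂ] E}
    (hg : M.IsPwConst g)
    (hfg : ∀ᵐ x ∂(volume.restrict G.Ω), ∀ a b, inner ℂ b (f x a) = inner ℂ (g x b) a)
    (v : Lp E 2 (volume.restrict G.Ω)) (w : Lp E' 2 (volume.restrict G.Ω)) :
    inner ℂ w (mulOp hf v) = inner ℂ (mulOp hg w) v := by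
  rw [L2.inner_def, L2.inner_def]
  refine integral_congr_ae ?_
  filter_upwards [hfg, mulOp_ae hf v, mulOp_ae hg w] with x h1 h2 h3
  rw [h2, h3, h1]

theorem norm_sq_eq_integral (v : Lp E 2 (volume.restrict G.Ω)) :
    ‖v‖ ^ 2 = ∫ x in G.Ω, ‖v x‖ ^ 2 := by
  rw [← inner_self_eq_norm_sq (𝕜 := ℂ), L2.inner_def, ← integral_re (L2.integrable_inner v v)]
  simp only [inner_self_eq_norm_sq]

/-- Multiplication by a real scalar weight. -/
def scalarOp {w : RVec n → ℝ} (hw : M.IsPwConst w) : L2 G.Ω →L[ℂ] L2 G.Ω :=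
  mulOp (hw.comp fun a => (a : ℂ) • ContinuousLinearMap.id ℂ ℂ)

theorem scalarOp_ae {w : RVec n → ℝ} (hw : M.IsPwConst w) (v : L2 G.Ω) :
    ∀ᵐ x ∂(volume.restrict G.Ω), scalarOp hw v x = w x * v x := by
  filter_upwards [mulOp_ae (hw.comp fun a => (a : ℂ) • ContinuousLinearMap.id ℂ ℂ) v] with x hx
  rw [scalarOp, hx]
  simp

theorem inner_scalarOp {w : RVec n → ℝ} (hw : M.IsPwConst w) (v v' : L2 G.Ω) :
    inner ℂ v' (scalarOp hw v) = inner ℂ (scalarOp hw v') v := by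
  refine inner_mulOp _ _ (Eventually.of_forall fun x a b => ?_) v v'
  simp
  ring

/-- Multiplication by the square root of a real scalar weight. -/
def sqrtOp {w : RVec n → ℝ} (hw : M.IsPwConst w) : L2 G.Ω →L[ℂ] L2 G.Ω :=
  scalarOp (hw.comp Real.sqrt)

theorem inner_sqrtOp {w : RVec n → ℝ} (hw : M.IsPwConst w)
    (h0 : ∀ K ∈ M.elems, ∀ x ∈ elem K, 0 ≤ w x) (v v' : L2 G.Ω) :
    inner ℂ (sqrtOp hw v) (sqrtOp hw v') = inner ℂ (scalarOp hw v) v' := by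
  rw [sqrtOp, inner_scalarOp]
  congr 1
  refine Lp.ext ?_
  filter_upwards [M.ae_of_forall_elem h0, scalarOp_ae (hw.comp Real.sqrt) v,
    scalarOp_ae (hw.comp Real.sqrt) (scalarOp (hw.comp Real.sqrt) v), scalarOp_ae hw v]
    with x h1 h2 h3 h4
  rw [h3, h2, h4, ← mul_assoc, ← Complex.ofReal_mul, Real.mul_self_sqrt h1]

theorem wnorm_eq_norm {w : RVec n → ℝ} (hw : M.IsPwConst w)
    (h0 : ∀ K ∈ M.elems, ∀ x ∈ elem K, 0 ≤ w x) (v : L2 G.Ω) :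
    wnorm G.Ω w v = ‖sqrtOp hw v‖ := by
  rw [wnorm, ← Real.sqrt_sq (norm_nonneg (sqrtOp hw v)), norm_sq_eq_integral]
  congr 1
  refine integral_congr_ae ?_
  filter_upwards [M.ae_of_forall_elem h0, scalarOp_ae (hw.comp Real.sqrt) v] with x h1 h2
  rw [sqrtOp, h2, norm_mul, Complex.norm_real, Real.norm_of_nonneg (Real.sqrt_nonneg _), mul_pow,
    Real.sq_sqrt h1]

/-- Multiplication by a real matrix weight. -/
def matrixOp {W : RVec n → Matrix (Fin n) (Fin n) ℝ} (hW : M.IsPwConst W) :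
    L2v G.Ω →L[ℂ] L2v G.Ω :=
  mulOp (hW.comp realCLM)

theorem matrixOp_ae {W : RVec n → Matrix (Fin n) (Fin n) ℝ} (hW : M.IsPwConst W) (v : L2v G.Ω) :
    ∀ᵐ x ∂(volume.restrict G.Ω), matrixOp hW v x = realCLM (W x) (v x) :=
  mulOp_ae _ v

/-- Multiplication by a square root of a real matrix weight. -/
def rootOp {W : RVec n → Matrix (Fin n) (Fin n) ℝ} (hW : M.IsPwConst W) :
    L2v G.Ω →L[ℂ] L2v G.Ω :=
  matrixOp (hW.comp matrixRoot)

theorem inner_rootOp {W : RVec n → Matrix (Fin n) (Fin n) ℝ} (hW : M.IsPwConst W)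
    (h0 : ∀ K ∈ M.elems, ∀ x ∈ elem K, (W x).PosSemidef) (v v' : L2v G.Ω) :
    inner ℂ (rootOp hW v) (rootOp hW v') = inner ℂ v (matrixOp hW v') := by
  rw [L2.inner_def, L2.inner_def]
  refine integral_congr_ae ?_
  filter_upwards [M.ae_of_forall_elem h0, matrixOp_ae (hW.comp matrixRoot) v,
    matrixOp_ae (hW.comp matrixRoot) v', matrixOp_ae hW v'] with x h1 h2 h3 h4
  rw [rootOp, h2, h3, h4, inner_matrixRoot h1]

theorem wnormV_congr {W : RVec n → Matrix (Fin n) (Fin n) ℝ} {v w : RVec n → CVec n}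
    (h : v =ᵐ[volume.restrict G.Ω] w) : wnormV G.Ω W v = wnormV G.Ω W w := by
  rw [wnormV, wnormV]
  congr 1
  refine integral_congr_ae ?_
  filter_upwards [h] with x hx
  rw [hx]

theorem wnormV_eq_norm {W : RVec n → Matrix (Fin n) (Fin n) ℝ} (hW : M.IsPwConst W)
    (h0 : ∀ K ∈ M.elems, ∀ x ∈ elem K, (W x).PosSemidef) (v : L2v G.Ω) :
    wnormV G.Ω W v = ‖rootOp hW v‖ := by
  rw [wnormV, ← Real.sqrt_sq (norm_nonneg (rootOp hW v)), norm_sq_eq_integral]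
  congr 1
  refine integral_congr_ae ?_
  filter_upwards [M.ae_of_forall_elem h0, matrixOp_ae (hW.comp matrixRoot) v] with x h1 h2
  rw [rootOp, h2, re_inner_realCLM, ← inner_matrixRoot h1]
  exact inner_self_eq_norm_sq (𝕜 := ℂ) _

/-- Cauchy–Schwarz inequality for a matrix weight and its inverse. -/
theorem norm_inner_le_rootOp {W : RVec n → Matrix (Fin n) (Fin n) ℝ} (hW : M.IsPwConst W)
    (h0 : ∀ K ∈ M.elems, ∀ x ∈ elem K, (W x).PosDef) (v w : L2v G.Ω) :
    ‖inner ℂ v w‖ ≤ ‖rootOp (hW.comp (·⁻¹)) v‖ * ‖rootOp hW w‖ := by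
  have hW' : M.IsPwConst fun x => (W x)⁻¹ := hW.comp (·⁻¹)
  have hs : ∀ K ∈ M.elems, ∀ x ∈ elem K, (W x).PosSemidef :=
    fun K hK x hx => (h0 K hK x hx).posSemidef
  have hs' : ∀ K ∈ M.elems, ∀ x ∈ elem K, ((W x)⁻¹).PosSemidef :=
    fun K hK x hx => (h0 K hK x hx).inv.posSemidef
  -- With `s = W⁻¹ v`, the pairing of `v = W s` with `w` is the `W`-weighted pairing of `s` with
  -- `w`, and the `W`-norm of `s` is the `W⁻¹`-norm of `v`.
  set s := matrixOp hW' v with hsdef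
  have e : matrixOp hW s = v := by
    refine Lp.ext ?_
    filter_upwards [M.ae_of_forall_elem h0, matrixOp_ae hW s, matrixOp_ae hW' v] with x h1 h2 h3
    rw [h2, h3, ← realCLM_mul, Matrix.mul_nonsing_inv _ ((Matrix.isUnit_iff_isUnit_det _).1 h1.isUnit), realCLM_one]
  have e1 : inner ℂ v w = inner ℂ (rootOp hW s) (rootOp hW w) := by
    rw [← inner_conj_symm, ← inner_conj_symm (rootOp hW s), inner_rootOp hW hs, e]
  have e2 : ‖rootOp hW s‖ ^ 2 = ‖rootOp hW' v‖ ^ 2 := by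
    rw [← inner_self_eq_norm_sq (𝕜 := ℂ), ← inner_self_eq_norm_sq (𝕜 := ℂ),
      inner_rootOp hW hs, inner_rootOp hW' hs', e, ← inner_conj_symm, RCLike.conj_re]
  have e3 : ‖rootOp hW s‖ = ‖rootOp hW' v‖ :=
    (sq_eq_sq₀ (norm_nonneg _) (norm_nonneg _)).1 e2
  rw [e1]
  exact (norm_inner_le_norm _ _).trans (le_of_eq (by rw [e3]))

end Multiplication

/-! ### Norms of linear maps on a normalized set -/

section NormalizedSup

variable {X Y Z : Type*} [AddCommGroup X] [Module ℂ X] [NormedAddCommGroup Y] [NormedSpace ℂ Y]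
  [NormedAddCommGroup Z] [NormedSpace ℂ Z]

/-- The norms `‖L x‖` over the vectors normalized by `k ‖S x‖ = 1`. -/
def normalizedNorms (k : ℝ) (S : X →ₗ[ℂ] Z) (L : X →ₗ[ℂ] Y) : Set ℝ :=
  {t | ∃ x, k * ‖S x‖ = 1 ∧ t = ‖L x‖}

theorem sSup_normalizedNorms_nonneg (k : ℝ) (S : X →ₗ[ℂ] Z) (L : X →ₗ[ℂ] Y) :
    0 ≤ sSup (normalizedNorms k S L) :=
  Real.sSup_nonneg fun _ ⟨_, _, e⟩ => e ▸ norm_nonneg _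

theorem norm_le_sSup_normalizedNorms {k : ℝ} (hk : 0 < k) {S : X →ₗ[ℂ] Z} {L : X →ₗ[ℂ] Y}
    (hb : BddAbove (normalizedNorms k S L)) (h0 : ∀ x, S x = 0 → L x = 0) (x : X) :
    ‖L x‖ ≤ sSup (normalizedNorms k S L) * (k * ‖S x‖) := by
  by_cases hx : S x = 0
  · simp [hx, h0 x hx]
  have hpos : 0 < k * ‖S x‖ := mul_pos hk (norm_pos_iff.2 hx)
  set a : ℝ := (k * ‖S x‖)⁻¹ with ha
  have hapos : 0 < a := inv_pos.2 hpos
  have hna : ‖(a : ℂ)‖ = a := by rw [Complex.norm_real, Real.norm_of_nonneg hapos.le]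
  have hmem : a * ‖L x‖ ∈ normalizedNorms k S L := by
    refine ⟨(a : ℂ) • x, ?_, ?_⟩
    · rw [map_smul, norm_smul, hna, mul_left_comm]
      exact inv_mul_cancel₀ hpos.ne'
    · rw [map_smul, norm_smul, hna]
  have h := le_csSup hb hmem
  rw [ha, inv_mul_le_iff₀ hpos] at h
  linarith

/-- If the normalized norms are bounded, then `L` vanishes on the kernel of `S`. -/
theorem eq_zero_of_bddAbove_normalizedNorms {k : ℝ} (hk : 0 < k) {S : X →ₗ[ℂ] Z}
    {L : X →ₗ[ℂ] Y} (hb : BddAbove (normalizedNorms k S L)) {y : X} (hy : S y ≠ 0) {x : X}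
    (hx : S x = 0) : L x = 0 := by
  obtain ⟨C, hC⟩ := hb
  by_contra hne
  have hpos : 0 < k * ‖S y‖ := mul_pos hk (norm_pos_iff.2 hy)
  set a : ℝ := (k * ‖S y‖)⁻¹ with ha
  have hapos : 0 < a := inv_pos.2 hpos
  have hna : ‖(a : ℂ)‖ = a := by rw [Complex.norm_real, Real.norm_of_nonneg hapos.le]
  have hLx : 0 < ‖L x‖ := norm_pos_iff.2 hne
  obtain ⟨N, hN⟩ := exists_nat_gt ((C + ‖L ((a : ℂ) • y)‖) / ‖L x‖)
  rw [div_lt_iff₀ hLx] at hN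
  -- Adding a kernel vector of `S` keeps the normalization, while the norm under `L` would grow
  -- without bound. A vector `y` outside the kernel is needed, since otherwise no vector is
  -- normalized and the bound says nothing.
  have hmem : ‖L ((a : ℂ) • y + (N : ℂ) • x)‖ ∈ normalizedNorms k S L := by
    refine ⟨_, ?_, rfl⟩
    rw [map_add, map_smul, map_smul, hx, smul_zero, add_zero, norm_smul, hna, mul_left_comm]
    exact inv_mul_cancel₀ hpos.ne'
  have h1 := hC hmem
  have h2 : ‖(N : ℂ) • L x‖ ≤ ‖L ((a : ℂ) • y + (N : ℂ) • x)‖ + ‖L ((a : ℂ) • y)‖ := by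
    have e : (N : ℂ) • L x = L ((a : ℂ) • y + (N : ℂ) • x) - L ((a : ℂ) • y) := by
      rw [map_add, map_smul L (N : ℂ) x]
      abel
    rw [e]
    exact norm_sub_le _ _
  rw [norm_smul, Complex.norm_natCast] at h2
  linarith

/-- In finite dimension an injective `S` is bounded below, so the normalized vectors form a bounded
set on which the continuous map `L` is bounded. -/
theorem bddAbove_normalizedNorms {X : Type*} [NormedAddCommGroup X] [NormedSpace ℂ X]
    [FiniteDimensional ℂ X] {k : ℝ} {S : X →ₗ[ℂ] Z} (hS : ∀ x, S x = 0 → x = 0)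
    (L : X →ₗ[ℂ] Y) : BddAbove (normalizedNorms k S L) := by
  obtain ⟨c, -, hc⟩ := S.exists_antilipschitzWith (LinearMap.ker_eq_bot'.2 hS)
  refine ⟨‖LinearMap.toContinuousLinearMap L‖ * (c * k⁻¹), ?_⟩
  rintro t ⟨x, hx, rfl⟩
  have h1 : ‖x‖ ≤ c * ‖S x‖ := by simpa using hc.le_mul_dist x 0
  have h2 : ‖S x‖ = k⁻¹ := by
    exact eq_inv_of_mul_eq_one_right hx
  rw [h2] at h1
  exact (LinearMap.toContinuousLinearMap L).le_opNorm_of_le h1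

theorem norm_le_sSup_normalizedNorms_of_injective {X : Type*} [NormedAddCommGroup X]
    [NormedSpace ℂ X] [FiniteDimensional ℂ X] {k : ℝ} (hk : 0 < k) {S : X →ₗ[ℂ] Z}
    (hS : ∀ x, S x = 0 → x = 0) (L : X →ₗ[ℂ] Y) (x : X) :
    ‖L x‖ ≤ sSup (normalizedNorms k S L) * (k * ‖S x‖) :=
  norm_le_sSup_normalizedNorms hk (bddAbove_normalizedNorms hS L)
    (fun y hy => by rw [hS y hy, map_zero]) x

end NormalizedSup

variable {n : ℕ} {G : Domain n} {M : Mesh G}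

/-! ### Piecewise polynomials and the projection -/

section Projection

theorem scalarOp_mem_pwPoly {w : RVec n → ℝ} (hw : M.IsPwConst w) {q : ℕ} {θ : L2 G.Ω}
    (hθ : θ ∈ M.PwPoly q) : scalarOp hw θ ∈ M.PwPoly q := by
  intro K hK
  obtain ⟨P, hP, e⟩ := hθ K hK
  refine ⟨(w (K.centroid ℝ id) : ℂ) • P, (MvPolynomial.totalDegree_smul_le _ _).trans hP, ?_⟩
  filter_upwards [e, M.ae_elem hK (scalarOp_ae hw θ),
    ae_restrict_mem isOpen_interior.measurableSet] with x h1 h2 hx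
  rw [h2, h1, MvPolynomial.smul_eval, hw K hK x hx _ (centroid_mem_elem M hK)]

/-- The weight can be moved onto `θ`, and `w θ` is still a piecewise polynomial of the same degree;
so the unweighted projection is orthogonal in the weighted form as well. -/
theorem inner_sqrtOp_sub_proj {w : RVec n → ℝ} (hw : M.IsPwConst w)
    (h0 : ∀ K ∈ M.elems, ∀ x ∈ elem K, 0 ≤ w x) {q : ℕ} {θ : L2 G.Ω} (hθ : θ ∈ M.PwPoly q)
    (u : L2 G.Ω) :
    inner ℂ (sqrtOp hw θ) (sqrtOp hw (u - (M.proj q u : L2 G.Ω))) = 0 := by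
  rw [inner_sqrtOp hw h0, ← inner_conj_symm]
  have h := Submodule.starProjection_inner_eq_zero (K := M.PwPoly q) u _ (scalarOp_mem_pwPoly hw hθ)
  have e : ((M.proj q u : M.PwPoly q) : L2 G.Ω) = (M.PwPoly q).starProjection u := rfl
  rw [e, h, map_zero]

/-- Pythagoras. A general `θ` yields best approximation in the weighted norm; `θ = 0` yields the
contraction property and the splitting of `‖u‖_𝔭²`. -/
theorem norm_sqrtOp_sq_eq_add {w : RVec n → ℝ} (hw : M.IsPwConst w)
    (h0 : ∀ K ∈ M.elems, ∀ x ∈ elem K, 0 ≤ w x) {q : ℕ} {θ : L2 G.Ω} (hθ : θ ∈ M.PwPoly q)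
    (u : L2 G.Ω) :
    ‖sqrtOp hw (u - θ)‖ ^ 2 = ‖sqrtOp hw (u - (M.proj q u : L2 G.Ω))‖ ^ 2 +
      ‖sqrtOp hw ((M.proj q u : L2 G.Ω) - θ)‖ ^ 2 := by
  have e : u - θ = ((M.proj q u : L2 G.Ω) - θ) + (u - (M.proj q u : L2 G.Ω)) := by abel
  have h := inner_sqrtOp_sub_proj hw h0 (sub_mem (M.proj q u).2 hθ) u
  rw [e, map_add, @norm_add_sq ℂ, h]
  simp
  ring

theorem integral_eq_sum_elem (M : Mesh G) {f : RVec n → ℝ} (hf : IntegrableOn f G.Ω) :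
    ∫ x in G.Ω, f x = ∑ K ∈ M.elems, ∫ x in elem K, f x := by
  rw [← integral_biUnion_finset (s := elem) _ (fun K _ => isOpen_interior.measurableSet) ?_
    fun K hK => hf.mono_set (M.subset K hK)]
  · refine setIntegral_congr_set ?_
    refine Filter.EventuallyLE.antisymm ?_ ?_
    · have h := (ae_restrict_iff' G.isOpen.measurableSet).1 M.ae_exists_elem
      filter_upwards [h] with x hx hxΩ
      obtain ⟨K, hK, hxK⟩ := hx hxΩ
      exact Set.mem_biUnion hK hxK
    · exact (Set.iUnion₂_subset M.subset).eventuallyLE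
  · intro K hK K' hK' hne
    exact Set.disjoint_left.2 fun x hx hx' => hne (M.elem_disjoint K hK K' hK' x hx hx')

theorem convex_elem (K : Finset (RVec n)) : Convex ℝ (elem K) :=
  (convex_convexHull ℝ _).interior

theorem isBounded_elem (K : Finset (RVec n)) : Bornology.IsBounded (elem K) :=
  (isBounded_convexHull.2 K.finite_toSet.isBounded).subset interior_subset

theorem volume_real_elem_pos (M : Mesh G) {K : Finset (RVec n)} (hK : K ∈ M.elems) :
    0 < volume.real (elem K) :=
  ENNReal.toReal_pos (isOpen_interior.measure_pos volume ⟨_, centroid_mem_elem M hK⟩).ne'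
    (isBounded_elem K).measure_lt_top.ne

theorem elemDiam_pos (hn : 0 < n) (M : Mesh G) {K : Finset (RVec n)} (hK : K ∈ M.elems) :
    0 < elemDiam K := by
  have : Nonempty (Fin n) := ⟨⟨0, hn⟩⟩
  by_contra hcon
  have h0 : Metric.diam (elem K) = 0 := le_antisymm (not_lt.1 hcon) Metric.diam_nonneg
  have hs : (elem K).Subsingleton := fun x hx y hy => by
    have := Metric.dist_le_diam_of_mem (isBounded_elem K) hx hy
    rw [h0] at this
    exact dist_le_zero.1 this
  have hv := volume_real_elem_pos M hK
  rw [Measure.real, hs.measure_zero] at hv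
  simp at hv

/-- The piecewise constant function with given values on the elements. -/
theorem exists_pwConst (M : Mesh G) (c : Finset (RVec n) → ℂ) (q : ℕ) :
    ∃ θ ∈ M.PwPoly q, ∀ᵐ x ∂(volume.restrict G.Ω), ∀ K ∈ M.elems, x ∈ elem K → θ x = c K := by
  have hmem : MemLp (fun x => ∑ K ∈ M.elems, (elem K).indicator (fun _ => c K) x) 2
      (volume.restrict G.Ω) := by
    refine memLp_finsetSum _ fun K _ => MemLp.restrict _ ?_
    exact memLp_indicator_const 2 isOpen_interior.measurableSet _
      (Or.inr (isBounded_elem K).measure_lt_top.ne)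
  have hval : ∀ᵐ x ∂(volume.restrict G.Ω), ∀ K ∈ M.elems, x ∈ elem K → hmem.toLp _ x = c K := by
    filter_upwards [hmem.coeFn_toLp] with x hx K hK hxK
    rw [hx, Finset.sum_eq_single_of_mem K hK, Set.indicator_of_mem hxK]
    intro K' hK' hne
    exact Set.indicator_of_notMem (fun h => hne (M.elem_disjoint K' hK' K hK x h hxK)) _
  refine ⟨hmem.toLp _, fun K hK => ⟨MvPolynomial.C (c K), by simp, ?_⟩, hval⟩
  filter_upwards [M.ae_elem hK hval, ae_restrict_mem isOpen_interior.measurableSet] with x hx hxK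
  rw [hx K hK hxK, MvPolynomial.eval_C]

end Projection

/-! ### Approximation by piecewise polynomials -/

section Approximation

variable (D : Coeffs M)

theorem memLp_cgrad_field {φ : RVec n → ℂ} (h : ContDiff ℝ ∞ φ) (hc : HasCompactSupport φ)
    (Ω : Set (RVec n)) : MemLp (cgrad φ) 2 (volume.restrict Ω) := by
  refine ((continuous_cgrad h).memLp_of_hasCompactSupport ?_).restrict Ω
  refine (hc.fderiv (𝕜 := ℝ)).mono fun x hx => ?_
  contrapose! hx
  simp only [Function.mem_support, not_not] at hx ⊢
  ext i
  simp [cgrad, hx]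

theorem Coeffs.wA_posSemidef {K : Finset (RVec n)} (hK : K ∈ M.elems) {x : RVec n}
    (hx : x ∈ elem K) : (D.wA x).PosSemidef :=
  (D.wA_posDef K hK x hx).posSemidef

/-- Poincaré inequality on an element, in weighted norms. -/
theorem Coeffs.integral_elem_le (hn : 0 < n) (hn3 : n ≤ 3) {K : Finset (RVec n)}
    (hK : K ∈ M.elems) {φ : RVec n → ℂ} (h : ContDiff ℝ ∞ φ) (hc : HasCompactSupport φ) :
    ∫ x in elem K, D.wp x * ‖φ x - (volume.real (elem K) : ℂ)⁻¹ * ∫ y in elem K, φ y‖ ^ 2 ≤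
      (elemDiam K * D.invSpeed K) ^ 2 *
        ∫ x in elem K, ‖rootOp D.wA_const ((memLp_cgrad_field h hc G.Ω).toLp _) x‖ ^ 2 := by
  set g := (memLp_cgrad_field h hc G.Ω).toLp _ with hg
  have hcen := centroid_mem_elem M hK
  have hm : MeasurableSet (elem K) := isOpen_interior.measurableSet
  have hα : 0 < D.alphaMin K := sInf_spectrum_pos hn (D.wA_posDef K hK _ hcen)
  have hp : 0 ≤ D.pOn K := D.wp_nonneg K hK _ hcen
  have e1 : ∫ x in elem K, D.wp x * ‖φ x - (volume.real (elem K) : ℂ)⁻¹ * ∫ y in elem K, φ y‖ ^ 2 =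
      D.pOn K * ∫ x in elem K, ‖φ x - (volume.real (elem K) : ℂ)⁻¹ * ∫ y in elem K, φ y‖ ^ 2 := by
    rw [← integral_const_mul (D.pOn K)]
    refine integral_congr_ae ?_
    filter_upwards [ae_restrict_mem hm] with x hx
    rw [Coeffs.pOn, D.wp_const K hK x hx _ hcen]
  have hP := integral_norm_sub_mean_sq_le hn3 (convex_elem K) (isBounded_elem K) hm
    (elemDiam_pos hn M hK) (volume_real_elem_pos M hK) h
  have i1 : IntegrableOn (fun x => ‖rootOp D.wA_const g x‖ ^ 2) (elem K) :=
    IntegrableOn.mono_set (Lp.memLp (rootOp D.wA_const g)).norm.integrable_sq (M.subset K hK)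
  have i2 : IntegrableOn (fun x => ‖cgrad φ x‖ ^ 2) (elem K) :=
    IntegrableOn.mono_set (memLp_cgrad_field h hc G.Ω).norm.integrable_sq (M.subset K hK)
  have hB : D.alphaMin K * ∫ x in elem K, ‖cgrad φ x‖ ^ 2 ≤
      ∫ x in elem K, ‖rootOp D.wA_const g x‖ ^ 2 := by
    rw [← integral_const_mul]
    refine integral_mono_ae (i2.const_mul _) i1 ?_
    filter_upwards [M.ae_elem hK (matrixOp_ae (D.wA_const.comp matrixRoot) g),
      M.ae_elem hK (memLp_cgrad_field h hc G.Ω).coeFn_toLp, ae_restrict_mem hm] with x h1 h2 hx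
    rw [rootOp, h1, hg, h2, Coeffs.alphaMin, D.wA_const K hK _ hcen x hx]
    exact sInf_spectrum_mul_norm_sq_le (D.wA_posSemidef hK hx) _
  -- Working with the reciprocal of the wavespeed makes `p_K = 0` an ordinary case.
  have hsq : (elemDiam K * D.invSpeed K) ^ 2 = elemDiam K ^ 2 * D.pOn K / D.alphaMin K := by
    rw [mul_pow, Coeffs.invSpeed, Real.sq_sqrt (div_nonneg hp hα.le), mul_div_assoc]
  rw [e1, hsq]
  calc _ ≤ D.pOn K * (elemDiam K ^ 2 * ∫ x in elem K, ‖cgrad φ x‖ ^ 2) :=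
        mul_le_mul_of_nonneg_left hP hp
    _ = elemDiam K ^ 2 * D.pOn K / D.alphaMin K *
          (D.alphaMin K * ∫ x in elem K, ‖cgrad φ x‖ ^ 2) := by field_simp
    _ ≤ _ := mul_le_mul_of_nonneg_left hB (by positivity)

theorem Coeffs.exists_pwPoly_approx (hn : 0 < n) (hn3 : n ≤ 3) {η : ℝ} (hη : 0 ≤ η)
    (hmax : ∀ K ∈ M.elems, elemDiam K * D.invSpeed K ≤ η) (q : ℕ)
    {φ : RVec n → ℂ} (h : ContDiff ℝ ∞ φ) (hc : HasCompactSupport φ) :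
    ∃ θ ∈ M.PwPoly q, ‖sqrtOp D.wp_const ((memLp_fun (Ω := G.Ω) h hc).toLp _ - θ)‖ ≤
      η * ‖rootOp D.wA_const ((memLp_cgrad_field h hc G.Ω).toLp _)‖ := by
  -- The approximant takes the element means as values; being piecewise constant, it lies in `Q_h`
  -- for every `q ≥ 0`.
  obtain ⟨θ, hθ, hval⟩ := exists_pwConst M
    (fun K => (volume.real (elem K) : ℂ)⁻¹ * ∫ y in elem K, φ y) q
  refine ⟨θ, hθ, ?_⟩
  set f := (memLp_fun (Ω := G.Ω) h hc).toLp φ with hf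
  set g := (memLp_cgrad_field h hc G.Ω).toLp _ with hg
  refine (sq_le_sq₀ (norm_nonneg _) (mul_nonneg hη (norm_nonneg _))).1 ?_
  rw [mul_pow, norm_sq_eq_integral, norm_sq_eq_integral (rootOp D.wA_const g),
    integral_eq_sum_elem M (Lp.memLp _).norm.integrable_sq,
    integral_eq_sum_elem M (Lp.memLp _).norm.integrable_sq, Finset.mul_sum]
  refine Finset.sum_le_sum fun K hK => ?_
  have hm : MeasurableSet (elem K) := isOpen_interior.measurableSet
  have e : ∫ x in elem K, ‖sqrtOp D.wp_const (f - θ) x‖ ^ 2 =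
      ∫ x in elem K, D.wp x * ‖φ x - (volume.real (elem K) : ℂ)⁻¹ * ∫ y in elem K, φ y‖ ^ 2 := by
    refine integral_congr_ae ?_
    filter_upwards [M.ae_elem hK (scalarOp_ae (D.wp_const.comp Real.sqrt) (f - θ)),
      M.ae_elem hK (Lp.coeFn_sub f θ), M.ae_elem hK (memLp_fun (Ω := G.Ω) h hc).coeFn_toLp,
      M.ae_elem hK hval, ae_restrict_mem hm] with x h1 h2 h3 h4 hx
    rw [sqrtOp, h1, h2, Pi.sub_apply, hf, h3, h4 K hK hx, norm_mul, Complex.norm_real,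
      Real.norm_of_nonneg (Real.sqrt_nonneg _), mul_pow, Real.sq_sqrt (D.wp_nonneg K hK x hx)]
  rw [e]
  refine (D.integral_elem_le hn hn3 hK h hc).trans ?_
  have h1 : 0 ≤ ∫ x in elem K, ‖rootOp D.wA_const g x‖ ^ 2 := integral_nonneg fun x => sq_nonneg _
  have h2 : 0 ≤ elemDiam K * D.invSpeed K := mul_nonneg Metric.diam_nonneg (Real.sqrt_nonneg _)
  have h3 := hmax K hK
  gcongr

/-- The projection error in the weighted norm, for functions of `H¹`. -/
theorem Coeffs.norm_sqrtOp_sub_proj_le (hn : 0 < n) (hn3 : n ≤ 3) {η : ℝ} (hη : 0 ≤ η)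
    (hmax : ∀ K ∈ M.elems, elemDiam K * D.invSpeed K ≤ η) (q : ℕ) {γ : Set (RVec n)}
    {u : L2 G.Ω × L2v G.Ω} (hu : u ∈ H1zero G.Ω γ) :
    ‖sqrtOp D.wp_const (u.1 - (M.proj q u.1 : L2 G.Ω))‖ ≤ η * ‖rootOp D.wA_const u.2‖ := by
  obtain ⟨-, φ, hφ, hf, hg, -⟩ := hu
  let f := fun j => (memLp_fun (Ω := G.Ω) (hφ j).1 (hφ j).2).toLp (φ j)
  let g := fun j => (memLp_cgrad_field (hφ j).1 (hφ j).2 G.Ω).toLp (cgrad (φ j))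
  have tf : Tendsto f atTop (𝓝 u.1) := by
    rw [Lp.tendsto_Lp_iff_tendsto_eLpNorm']
    refine hf.congr fun j => eLpNorm_congr_ae ?_
    filter_upwards [(memLp_fun (Ω := G.Ω) (hφ j).1 (hφ j).2).coeFn_toLp] with x hx
    simp [f, hx]
  have tg : Tendsto g atTop (𝓝 u.2) := by
    rw [Lp.tendsto_Lp_iff_tendsto_eLpNorm']
    refine hg.congr fun j => eLpNorm_congr_ae ?_
    filter_upwards [(memLp_cgrad_field (hφ j).1 (hφ j).2 G.Ω).coeFn_toLp] with x hx
    simp [g, hx]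
  -- For each `j` the sum bounds the projection error of `u`, by comparison with a piecewise
  -- constant approximation of the smooth function `φ j`; the limit is the claim.
  have t1 : Tendsto (fun j => ‖sqrtOp D.wp_const (u.1 - f j)‖ + η * ‖rootOp D.wA_const (g j)‖)
      atTop (𝓝 (0 + η * ‖rootOp D.wA_const u.2‖)) := by
    refine Tendsto.add ?_ (Tendsto.const_mul η
      (((rootOp D.wA_const).continuous.tendsto _).comp tg).norm)
    have := (((sqrtOp D.wp_const).continuous.tendsto _).comp (tf.const_sub u.1)).norm
    simpa using this
  rw [zero_add] at t1
  refine ge_of_tendsto' t1 fun j => ?_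
  obtain ⟨θ, hθ, hle⟩ := D.exists_pwPoly_approx hn hn3 hη hmax q (hφ j).1 (hφ j).2
  have h1 : ‖sqrtOp D.wp_const (u.1 - (M.proj q u.1 : L2 G.Ω))‖ ≤ ‖sqrtOp D.wp_const (u.1 - θ)‖ := by
    refine (sq_le_sq₀ (norm_nonneg _) (norm_nonneg _)).1 ?_
    rw [norm_sqrtOp_sq_eq_add D.wp_const D.wp_nonneg hθ u.1]
    exact le_add_of_nonneg_right (sq_nonneg _)
  have h2 : u.1 - θ = (u.1 - f j) + (f j - θ) := by abel
  rw [h2, map_add] at h1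
  exact h1.trans ((norm_add_le _ _).trans (add_le_add_right hle _))

end Approximation

/-! ### The sesquilinear form in terms of multiplication operators -/

section Form

/-- The operator `v ↦ (g, v)` for a piecewise constant field `g`. -/
def rowOp {g : RVec n → CVec n} (hg : M.IsPwConst g) : L2v G.Ω →L[ℂ] L2 G.Ω :=
  mulOp (hg.comp fun a => innerSL ℂ a)

theorem rowOp_ae {g : RVec n → CVec n} (hg : M.IsPwConst g) (v : L2v G.Ω) :
    ∀ᵐ x ∂(volume.restrict G.Ω), rowOp hg v x = ∑ i, conj (g x i) * v x i := by
  filter_upwards [mulOp_ae (hg.comp fun a => innerSL ℂ a) v] with x hx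
  rw [rowOp, hx, innerSL_apply_apply, PiLp.inner_apply]
  simp only [RCLike.inner_apply, mul_comm]

/-- The operator `z ↦ z g` for a piecewise constant field `g`. -/
def colOp {g : RVec n → CVec n} (hg : M.IsPwConst g) : L2 G.Ω →L[ℂ] L2v G.Ω :=
  mulOp (hg.comp fun a => ContinuousLinearMap.toSpanSingleton ℂ a)

theorem colOp_ae {g : RVec n → CVec n} (hg : M.IsPwConst g) (z : L2 G.Ω) :
    ∀ᵐ x ∂(volume.restrict G.Ω), colOp hg z x = z x • g x := by
  filter_upwards [mulOp_ae (hg.comp fun a => ContinuousLinearMap.toSpanSingleton ℂ a) z] with x hx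
  rw [colOp, hx, ContinuousLinearMap.toSpanSingleton_apply]

theorem inner_rowOp {g : RVec n → CVec n} (hg : M.IsPwConst g) (v : L2v G.Ω) (z : L2 G.Ω) :
    inner ℂ z (rowOp hg v) = inner ℂ (colOp hg z) v := by
  refine inner_mulOp _ _ (Eventually.of_forall fun x a b => ?_) v z
  simp only [innerSL_apply_apply, ContinuousLinearMap.toSpanSingleton_apply, inner_smul_left,
    RCLike.inner_apply]
  ring

namespace Coeffs

variable (D : Coeffs M)

/-- The field `i k b`. -/
def bField (x : RVec n) : CVec n := WithLp.toLp 2 fun i => Complex.I * D.k * D.b x i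

/-- The field `-i k c†`. -/
def cField (x : RVec n) : CVec n := WithLp.toLp 2 fun i => -(Complex.I * D.k * conj (D.c x i))

theorem bField_const : M.IsPwConst D.bField :=
  D.b_const.comp fun b => WithLp.toLp 2 fun i => Complex.I * D.k * b i

theorem cField_const : M.IsPwConst D.cField :=
  D.c_const.comp fun c => WithLp.toLp 2 fun i => -(Complex.I * D.k * conj (c i))

/-- Multiplication by `-k² d`. -/
def dOp : L2 G.Ω →L[ℂ] L2 G.Ω :=
  mulOp (D.d_const.comp fun d => (-(D.k : ℂ) ^ 2 * d) • ContinuousLinearMap.id ℂ ℂ)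

/-- Multiplication by `-k² d†`. -/
def dAdjOp : L2 G.Ω →L[ℂ] L2 G.Ω :=
  mulOp (D.d_const.comp fun d => (-(D.k : ℂ) ^ 2 * conj d) • ContinuousLinearMap.id ℂ ℂ)

/-- Multiplication by `A`. -/
def aOp : L2v G.Ω →L[ℂ] L2v G.Ω :=
  mulOp (D.A_const.comp fun A => Matrix.toEuclideanCLM (𝕜 := ℂ) A)

/-- Multiplication by `A†`. -/
def aAdjOp : L2v G.Ω →L[ℂ] L2v G.Ω :=
  mulOp (D.A_const.comp fun A => Matrix.toEuclideanCLM (𝕜 := ℂ) A.conjTranspose)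

theorem inner_dOp (u v : L2 G.Ω) : inner ℂ v (D.dOp u) = inner ℂ (D.dAdjOp v) u := by
  refine inner_mulOp _ _ (Eventually.of_forall fun x a b => ?_) u v
  simp
  ring

theorem inner_aOp (u v : L2v G.Ω) : inner ℂ v (D.aOp u) = inner ℂ (D.aAdjOp v) u := by
  refine inner_mulOp _ _ (Eventually.of_forall fun x a b => ?_) u v
  have h : Matrix.toEuclideanCLM (𝕜 := ℂ) (D.A x).conjTranspose =
      ContinuousLinearMap.adjoint (Matrix.toEuclideanCLM (𝕜 := ℂ) (D.A x)) :=
    map_star (Matrix.toEuclideanCLM (𝕜 := ℂ)) (D.A x)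
  rw [h, ContinuousLinearMap.adjoint_inner_left]

/-- As `rowOp` conjugates its field, `rowOp` of `-ikc†` is `v ↦ ikc·v`, while `colOp` of the same
field is the term `-ikc† z` of the residual. Likewise `colOp` of `ikb` serves the form and `rowOp`
of `ikb` the divergence of the flux. -/
theorem beta_eq (u v : L2 G.Ω × L2v G.Ω) :
    D.beta u v = inner ℂ v.1 (D.dOp u.1 + rowOp D.cField_const u.2) +
      inner ℂ v.2 (colOp D.bField_const u.1 + D.aOp u.2) := by
  rw [beta, L2.inner_def, L2.inner_def]
  congr 1
  · refine integral_congr_ae ?_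
    filter_upwards [Lp.coeFn_add (D.dOp u.1) (rowOp D.cField_const u.2),
      mulOp_ae (D.d_const.comp fun d => (-(D.k : ℂ) ^ 2 * d) • ContinuousLinearMap.id ℂ ℂ) u.1,
      rowOp_ae D.cField_const u.2] with x h1 h2 h3
    rw [h1, Pi.add_apply, dOp, h2, h3, RCLike.inner_apply]
    simp [cField, Finset.mul_sum, mul_assoc]
  · refine integral_congr_ae ?_
    filter_upwards [Lp.coeFn_add (colOp D.bField_const u.1) (D.aOp u.2),
      colOp_ae D.bField_const u.1,
      mulOp_ae (D.A_const.comp fun A => Matrix.toEuclideanCLM (𝕜 := ℂ) A) u.2] with x h1 h2 h3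
    rw [h1, Pi.add_apply, aOp, h2, h3, PiLp.inner_apply]
    refine Finset.sum_congr rfl fun i _ => ?_
    rw [RCLike.inner_apply, PiLp.add_apply, PiLp.smul_apply, Matrix.ofLp_toEuclideanCLM,
      smul_eq_mul, mul_comm (u.1 x)]
    rfl

/-- All coefficients are moved onto the second argument, where they can be matched with the
divergence of the flux and with the residual. -/
theorem beta_eq_adj (u v : L2 G.Ω × L2v G.Ω) :
    D.beta u v = inner ℂ (D.dAdjOp v.1) u.1 + inner ℂ (rowOp D.bField_const v.2) u.1 +
      (inner ℂ (D.aAdjOp v.2) u.2 + inner ℂ (colOp D.cField_const v.1) u.2) := by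
  have e : inner ℂ v.2 (colOp D.bField_const u.1) = inner ℂ (rowOp D.bField_const v.2) u.1 := by
    rw [← inner_conj_symm, ← inner_rowOp, inner_conj_symm]
  rw [beta_eq, inner_add_right, inner_add_right, inner_dOp, inner_rowOp, e, inner_aOp]
  ring

theorem beta_add_right (u v w : L2 G.Ω × L2v G.Ω) :
    D.beta u (v + w) = D.beta u v + D.beta u w := by
  simp only [beta_eq, Prod.fst_add, Prod.snd_add, inner_add_left]
  ring

theorem beta_smul_right (a : ℂ) (u v : L2 G.Ω × L2v G.Ω) :
    D.beta u (a • v) = conj a * D.beta u v := by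
  simp only [beta_eq, Prod.smul_fst, Prod.smul_snd, inner_smul_left]
  ring

theorem integral_wp_eq (w θ : L2 G.Ω) :
    ∫ x in G.Ω, (D.wp x : ℂ) * w x * conj (θ x) = inner ℂ θ (scalarOp D.wp_const w) := by
  rw [L2.inner_def]
  refine integral_congr_ae ?_
  filter_upwards [scalarOp_ae D.wp_const w] with x hx
  rw [hx, RCLike.inner_apply]

/-! ### The discrete solution operator and the residual identity. -/

variable {D} {r q : ℕ}

theorem DiscreteWellPosed.isDiscreteSol (h : D.DiscreteWellPosed r q)
    (θ : M.PwPoly q) : D.IsDiscreteSol r θ (h.sol θ) :=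
  (h θ).choose_spec.1

theorem DiscreteWellPosed.eq_sol (h : D.DiscreteWellPosed r q)
    {θ : M.PwPoly q} {z : M.Lagrange r} (hz : D.IsDiscreteSol r θ z) : z = h.sol θ :=
  (h θ).choose_spec.2 z hz

/-- The discrete solution operator as a linear map. -/
def DiscreteWellPosed.solLin (h : D.DiscreteWellPosed r q) : M.PwPoly q →ₗ[ℂ] M.Lagrange r where
  toFun := h.sol
  map_add' θ η := by
    -- By uniqueness it is enough that the combination of solutions solves the problem for the
    -- combined datum. Both sides of the discrete equation are antilinear in their second slot, so
    -- the operator is linear rather than antilinear.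
    refine (h.eq_sol fun w hw => ?_).symm
    have h1 := h.isDiscreteSol θ w hw
    have h2 := h.isDiscreteSol η w hw
    rw [integral_wp_eq] at h1 h2 ⊢
    rw [Submodule.coe_add, beta_add_right, h1, h2, Submodule.coe_add, inner_add_left]
    ring
  map_smul' a θ := by
    refine (h.eq_sol fun w hw => ?_).symm
    have h1 := h.isDiscreteSol θ w hw
    rw [integral_wp_eq] at h1 ⊢
    rw [RingHom.id_apply, Submodule.coe_smul, beta_smul_right, h1, Submodule.coe_smul,
      inner_smul_left]
    ring

/-- The residual as a linear map into `L²`. -/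
def residualLin (h : D.DiscreteWellPosed r q) (F : M.PwPoly q →ₗ[ℂ] HdivZero G.Ω G.ΓD) :
    M.PwPoly q →ₗ[ℂ] L2v G.Ω :=
  ((D.aAdjOp : L2v G.Ω →ₗ[ℂ] L2v G.Ω) ∘ₗ LinearMap.snd ℂ _ _ +
    (colOp D.cField_const : L2 G.Ω →ₗ[ℂ] L2v G.Ω) ∘ₗ LinearMap.fst ℂ _ _) ∘ₗ
      (M.Lagrange r).subtype ∘ₗ h.solLin +
    LinearMap.fst ℂ _ _ ∘ₗ (HdivZero G.Ω G.ΓD).subtype ∘ₗ F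

theorem residualLin_apply (h : D.DiscreteWellPosed r q)
    (F : M.PwPoly q →ₗ[ℂ] HdivZero G.Ω G.ΓD) (θ : M.PwPoly q) :
    residualLin h F θ = D.aAdjOp (h.sol θ).1.2 + colOp D.cField_const (h.sol θ).1.1 +
      (F θ).1.1 := rfl

theorem residual_ae (h : D.DiscreteWellPosed r q) (F : M.PwPoly q →ₗ[ℂ] HdivZero G.Ω G.ΓD)
    (θ : M.PwPoly q) :
    D.residual h F θ =ᵐ[volume.restrict G.Ω] residualLin h F θ := by
  rw [residualLin_apply]
  set z := (h.sol θ).1 with hz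
  filter_upwards [Lp.coeFn_add (D.aAdjOp z.2 + colOp D.cField_const z.1) (F θ).1.1,
    Lp.coeFn_add (D.aAdjOp z.2) (colOp D.cField_const z.1), colOp_ae D.cField_const z.1,
    mulOp_ae (D.A_const.comp fun A => Matrix.toEuclideanCLM (𝕜 := ℂ) A.conjTranspose) z.2]
    with x h1 h2 h3 h4
  rw [h1, Pi.add_apply, h2, Pi.add_apply, h3, aAdjOp, h4]
  ext i
  simp only [residual, PiLp.add_apply, PiLp.smul_apply, Matrix.ofLp_toEuclideanCLM, smul_eq_mul,
    cField, ← hz, Matrix.mulVec, dotProduct]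
  ring

theorem flux_div_eq (h : D.DiscreteWellPosed r q) {F : M.PwPoly q →ₗ[ℂ] HdivZero G.Ω G.ΓD}
    (hF : D.IsFluxReconstruction h F) (θ : M.PwPoly q) :
    (F θ).1.2 = (D.k : ℂ) ^ 2 • scalarOp D.wp_const (θ : L2 G.Ω) -
      D.dAdjOp (h.sol θ).1.1 - rowOp D.bField_const (h.sol θ).1.2 := by
  set z := (h.sol θ).1 with hz
  refine Lp.ext ?_
  filter_upwards [hF θ,
    Lp.coeFn_sub ((D.k : ℂ) ^ 2 • scalarOp D.wp_const (θ : L2 G.Ω) - D.dAdjOp z.1)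
      (rowOp D.bField_const z.2),
    Lp.coeFn_sub ((D.k : ℂ) ^ 2 • scalarOp D.wp_const (θ : L2 G.Ω)) (D.dAdjOp z.1),
    Lp.coeFn_smul ((D.k : ℂ) ^ 2) (scalarOp D.wp_const (θ : L2 G.Ω)),
    scalarOp_ae D.wp_const (θ : L2 G.Ω),
    mulOp_ae (D.d_const.comp fun d => (-(D.k : ℂ) ^ 2 * conj d) • ContinuousLinearMap.id ℂ ℂ) z.1,
    rowOp_ae D.bField_const z.2] with x h1 h2 h3 h4 h5 h6 h7
  rw [h1, h2, Pi.sub_apply, h3, Pi.sub_apply, h4, Pi.smul_apply, h5, dAdjOp, h6, h7]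
  simp [bField, Finset.mul_sum, mul_assoc, hz]

theorem divPairing_eq_inner {Ω : Set (RVec n)} (s : L2v Ω × L2 Ω) (w : L2 Ω × L2v Ω) :
    divPairing s w = inner ℂ w.2 s.1 + inner ℂ w.1 s.2 := by
  rw [divPairing, L2.inner_def, L2.inner_def,
    ← integral_add (L2.integrable_inner w.2 s.1) (L2.integrable_inner w.1 s.2)]
  simp only [PiLp.inner_apply, RCLike.inner_apply]

/-- The form tested with a discrete solution, in terms of the residual. -/
theorem beta_sol (h : D.DiscreteWellPosed r q) {F : M.PwPoly q →ₗ[ℂ] HdivZero G.Ω G.ΓD}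
    (hF : D.IsFluxReconstruction h F) (θ : M.PwPoly q) {u : L2 G.Ω × L2v G.Ω}
    (hu : u ∈ H1zero G.Ω G.ΓD) :
    D.beta u (h.sol θ).1 = (D.k : ℂ) ^ 2 * inner ℂ (scalarOp D.wp_const (θ : L2 G.Ω)) u.1 +
      inner ℂ (residualLin h F θ) u.2 := by
  -- The integration by parts: the normal trace vanishes in the sense of duality with `H¹_{Γ_D}`, to
  -- which `u` belongs.
  have hdiv := (F θ).2.2 u hu
  rw [divPairing_eq_inner] at hdiv
  have hdiv' := congrArg conj hdiv
  rw [map_add, inner_conj_symm, inner_conj_symm, map_zero, flux_div_eq h hF] at hdiv'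
  rw [inner_sub_left, inner_sub_left, inner_smul_left, map_pow, Complex.conj_ofReal] at hdiv'
  have h1 : inner ℂ (residualLin h F θ) u.2 = inner ℂ (D.aAdjOp (h.sol θ).1.2) u.2 +
      inner ℂ (colOp D.cField_const (h.sol θ).1.1) u.2 + inner ℂ (F θ).1.1 u.2 :=
    (inner_add_left _ _ _).trans (congrArg (· + _) (inner_add_left _ _ _))
  have h2 := beta_eq_adj D u (h.sol θ).1
  refine h2.trans ?_
  refine Eq.trans ?_ (congrArg (_ + ·) h1.symm)
  -- Here `a1`, `a2` are the `d` and `b` terms of the form, `a3` is the datum term, `a4` the flux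
  -- against `∇u`, and `a5`, `a6` the `A` and `c` terms. The flux trades `a1 + a2` for `a3 + a4`.
  have key : ∀ a1 a2 a3 a4 a5 a6 : ℂ, a4 + (a3 - a1 - a2) = 0 →
      a1 + a2 + (a5 + a6) = a3 + (a5 + a6 + a4) := fun a1 a2 a3 a4 a5 a6 h => by
    linear_combination -h
  exact key _ _ _ _ _ _ hdiv'

end Coeffs

end Form

/-! ### Guaranteed bounds -/

namespace Coeffs

variable (D : Coeffs M)

theorem wm_nonneg : ∀ K ∈ M.elems, ∀ x ∈ elem K, 0 ≤ D.wm x :=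
  fun K hK x hx => (D.wm_pos K hK x hx).le

theorem wA_inv_posSemidef : ∀ K ∈ M.elems, ∀ x ∈ elem K, ((D.wA x)⁻¹).PosSemidef :=
  fun K hK x hx => (D.wA_posDef K hK x hx).inv.posSemidef

theorem energy_sq (u : L2 G.Ω × L2v G.Ω) :
    D.energy u ^ 2 = D.k ^ 2 * ‖sqrtOp D.wm_const u.1‖ ^ 2 + ‖rootOp D.wA_const u.2‖ ^ 2 := by
  rw [energy, Real.sq_sqrt (by positivity), wnorm_eq_norm D.wm_const D.wm_nonneg,
    wnormV_eq_norm D.wA_const fun K hK x hx => D.wA_posSemidef hK hx]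

/-- The linear map whose norm is the energy norm. -/
def energyMap : L2 G.Ω × L2v G.Ω →ₗ[ℂ] WithLp 2 (L2 G.Ω × L2v G.Ω) :=
  (WithLp.linearEquiv 2 ℂ (L2 G.Ω × L2v G.Ω)).symm.toLinearMap ∘ₗ
    LinearMap.prodMap ((D.k : ℂ) • (sqrtOp D.wm_const : L2 G.Ω →ₗ[ℂ] L2 G.Ω))
      (rootOp D.wA_const : L2v G.Ω →ₗ[ℂ] L2v G.Ω)

theorem energy_eq_norm (u : L2 G.Ω × L2v G.Ω) : D.energy u = ‖D.energyMap u‖ := by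
  have h0 : 0 ≤ D.energy u := Real.sqrt_nonneg _
  refine (sq_eq_sq₀ h0 (norm_nonneg _)).1 ?_
  rw [energy_sq, WithLp.prod_norm_sq_eq_of_L2]
  change _ = ‖(D.k : ℂ) • sqrtOp D.wm_const u.1‖ ^ 2 + ‖rootOp D.wA_const u.2‖ ^ 2
  rw [norm_smul, Complex.norm_real, Real.norm_of_nonneg D.k_pos.le, mul_pow]

theorem energy_nonneg (u : L2 G.Ω × L2v G.Ω) : 0 ≤ D.energy u := Real.sqrt_nonneg _

theorem energy_add_le (u v : L2 G.Ω × L2v G.Ω) : D.energy (u + v) ≤ D.energy u + D.energy v := by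
  simp only [energy_eq_norm, map_add]
  exact norm_add_le _ _

theorem energy_smul (a : ℂ) (u : L2 G.Ω × L2v G.Ω) : D.energy (a • u) = ‖a‖ * D.energy u := by
  simp only [energy_eq_norm, map_smul]
  exact norm_smul _ _

theorem _root_.InfSup.eq_zero_of_sqrtOp_eq_zero {w : RVec n → ℝ} (hw : M.IsPwConst w)
    (h0 : ∀ K ∈ M.elems, ∀ x ∈ elem K, 0 < w x) {v : L2 G.Ω} (hv : sqrtOp hw v = 0) : v = 0 := by
  refine Lp.ext ?_
  filter_upwards [scalarOp_ae (hw.comp Real.sqrt) v, M.ae_of_forall_elem h0,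
    Lp.coeFn_zero ℂ 2 (volume.restrict G.Ω)] with x h1 h2 h3
  rw [sqrtOp] at hv
  rw [hv, h3, Pi.zero_apply] at h1
  rw [h3, Pi.zero_apply]
  refine (mul_eq_zero.1 h1.symm).resolve_left ?_
  exact_mod_cast (Real.sqrt_pos.2 h2).ne'

/-- Both `𝔪` and the smallest eigenvalue of `𝔄` are positive almost everywhere. Needed to normalize
the test function in the inf-sup bound. -/
theorem eq_zero_of_energy_eq_zero (hn : 0 < n) {u : L2 G.Ω × L2v G.Ω} (hu : D.energy u = 0) :
    u = 0 := by
  have h := D.energy_sq u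
  rw [hu] at h
  have hk := D.k_pos
  have h1 : D.k ^ 2 * ‖sqrtOp D.wm_const u.1‖ ^ 2 = 0 := by
    nlinarith [sq_nonneg ‖rootOp D.wA_const u.2‖,
      mul_nonneg (sq_nonneg D.k) (sq_nonneg ‖sqrtOp D.wm_const u.1‖)]
  have h2 : ‖rootOp D.wA_const u.2‖ ^ 2 = 0 := by linarith
  have h1' : sqrtOp D.wm_const u.1 = 0 := by
    have := (mul_eq_zero.1 h1).resolve_left (by positivity)
    exact norm_eq_zero.1 (pow_eq_zero_iff two_ne_zero |>.1 this)
  have h2' : rootOp D.wA_const u.2 = 0 := norm_eq_zero.1 (pow_eq_zero_iff two_ne_zero |>.1 h2)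
  refine Prod.ext (eq_zero_of_sqrtOp_eq_zero D.wm_const D.wm_pos h1') (Lp.ext ?_)
  filter_upwards [matrixOp_ae (D.wA_const.comp matrixRoot) u.2, M.ae_of_forall_elem D.wA_posDef,
    Lp.coeFn_zero (CVec n) 2 (volume.restrict G.Ω)] with x e1 e2 e3
  rw [rootOp] at h2'
  rw [h2', e3, Pi.zero_apply] at e1
  have := sInf_spectrum_mul_norm_sq_le e2.posSemidef (u.2 x)
  rw [← e1, norm_zero] at this
  have hpos := sInf_spectrum_pos hn e2
  have hz : ‖u.2 x‖ ^ 2 ≤ 0 := by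
    by_contra hcon
    have := mul_pos hpos (not_le.1 hcon)
    linarith
  have hz' : ‖u.2 x‖ = 0 := by nlinarith [norm_nonneg (u.2 x)]
  rw [norm_eq_zero.1 hz']
  exact e3.symm

/-! ### The constants `Θ_h` and `ρ_h` as bounds for linear maps. -/

variable {D} {r q : ℕ}

theorem residualNorms_eq (h : D.DiscreteWellPosed r q) (F : M.PwPoly q →ₗ[ℂ] HdivZero G.Ω G.ΓD)
    {w : RVec n → ℝ} (hw : M.IsPwConst w) (h0 : ∀ K ∈ M.elems, ∀ x ∈ elem K, 0 ≤ w x) :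
    D.residualNorms h F w = normalizedNorms D.k
      ((sqrtOp hw : L2 G.Ω →ₗ[ℂ] L2 G.Ω) ∘ₗ (M.PwPoly q).subtype)
      ((rootOp (D.wA_const.comp (·⁻¹)) : L2v G.Ω →ₗ[ℂ] L2v G.Ω) ∘ₗ residualLin h F) := by
  simp only [residualNorms, wnormV_congr (residual_ae h F _), wnorm_eq_norm hw h0,
    wnormV_eq_norm (D.wA_const.comp (·⁻¹)) D.wA_inv_posSemidef]
  rfl

theorem thetaH_eq (h : D.DiscreteWellPosed r q) :
    D.thetaH h = sSup (normalizedNorms D.k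
      ((sqrtOp D.wm_const : L2 G.Ω →ₗ[ℂ] L2 G.Ω) ∘ₗ (M.PwPoly q).subtype)
      (D.energyMap ∘ₗ (M.Lagrange r).subtype ∘ₗ h.solLin)) := by
  simp only [thetaH, wnorm_eq_norm D.wm_const D.wm_nonneg, energy_eq_norm]
  rfl

theorem sqrtOp_wm_subtype_injective (θ : M.PwPoly q)
    (hθ : ((sqrtOp D.wm_const : L2 G.Ω →ₗ[ℂ] L2 G.Ω) ∘ₗ (M.PwPoly q).subtype) θ = 0) : θ = 0 :=
  Subtype.ext (eq_zero_of_sqrtOp_eq_zero D.wm_const D.wm_pos hθ)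

theorem thetaH_nonneg (h : D.DiscreteWellPosed r q) : 0 ≤ D.thetaH h := by
  rw [thetaH_eq]
  exact sSup_normalizedNorms_nonneg _ _ _

theorem energy_sol_le (h : D.DiscreteWellPosed r q) (θ : M.PwPoly q) :
    D.energy (h.sol θ) ≤ D.thetaH h * (D.k * ‖sqrtOp D.wm_const (θ : L2 G.Ω)‖) := by
  rw [thetaH_eq, energy_eq_norm]
  exact norm_le_sSup_normalizedNorms_of_injective D.k_pos sqrtOp_wm_subtype_injective
    (D.energyMap ∘ₗ (M.Lagrange r).subtype ∘ₗ h.solLin) θ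

theorem rhoH_nonneg (h : D.DiscreteWellPosed r q) (F : M.PwPoly q →ₗ[ℂ] HdivZero G.Ω G.ΓD)
    (w : RVec n → ℝ) : 0 ≤ D.rhoH h F w :=
  Real.sSup_nonneg fun _ ⟨_, _, e⟩ => e ▸ Real.sqrt_nonneg _

theorem residual_le_wm (h : D.DiscreteWellPosed r q) (F : M.PwPoly q →ₗ[ℂ] HdivZero G.Ω G.ΓD)
    (θ : M.PwPoly q) :
    ‖rootOp (D.wA_const.comp (·⁻¹)) (residualLin h F θ)‖ ≤
      D.rhoH h F D.wm * (D.k * ‖sqrtOp D.wm_const (θ : L2 G.Ω)‖) := by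
  rw [rhoH, residualNorms_eq h F D.wm_const D.wm_nonneg]
  exact norm_le_sSup_normalizedNorms_of_injective D.k_pos sqrtOp_wm_subtype_injective
    ((rootOp (D.wA_const.comp (·⁻¹)) : L2v G.Ω →ₗ[ℂ] L2v G.Ω) ∘ₗ residualLin h F) θ

/-- Some piecewise constant function has a nonzero weighted norm. -/
theorem exists_sqrtOp_wp_ne_zero (D : Coeffs M) (q : ℕ) :
    ∃ θ : M.PwPoly q, sqrtOp D.wp_const (θ : L2 G.Ω) ≠ 0 := by
  obtain ⟨K, hK, y, hy, hne⟩ := D.wp_ne_zero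
  obtain ⟨θ, hθ, hval⟩ := exists_pwConst M (fun _ => 1) q
  refine ⟨⟨θ, hθ⟩, fun h0 => ?_⟩
  have hpos : 0 < D.wp y := lt_of_le_of_ne (D.wp_nonneg K hK y hy) hne.symm
  have hfalse : ∀ᵐ x ∂(volume.restrict (elem K)), False := by
    filter_upwards [M.ae_elem hK hval, ae_restrict_mem isOpen_interior.measurableSet,
      M.ae_elem hK (scalarOp_ae (D.wp_const.comp Real.sqrt) θ),
      M.ae_elem hK (Lp.coeFn_zero ℂ 2 (volume.restrict G.Ω))] with x h1 h2 h3 h4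
    rw [sqrtOp] at h0
    rw [h0, h4, h1 K hK h2, Pi.zero_apply, mul_one, D.wp_const K hK x h2 y hy] at h3
    exact (Real.sqrt_pos.2 hpos).ne' (by exact_mod_cast h3.symm)
  have hv := volume_real_elem_pos M hK
  rw [ae_iff] at hfalse
  simp only [not_false_eq_true, Set.ofPred_true, Measure.restrict_apply_univ] at hfalse
  rw [Measure.real, hfalse] at hv
  simp at hv

/-- The weight `𝔭` may vanish on elements and give only a seminorm on `Q_h`. Finiteness of the
supremum forces the residual to vanish on its kernel, and `𝔭 ≢ 0` provides the normalizable datum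
which that argument requires. -/
theorem residual_le_wp (h : D.DiscreteWellPosed r q) (F : M.PwPoly q →ₗ[ℂ] HdivZero G.Ω G.ΓD)
    (hb : BddAbove (D.residualNorms h F D.wp)) (θ : M.PwPoly q) :
    ‖rootOp (D.wA_const.comp (·⁻¹)) (residualLin h F θ)‖ ≤
      D.rhoH h F D.wp * (D.k * ‖sqrtOp D.wp_const (θ : L2 G.Ω)‖) := by
  obtain ⟨η, hη⟩ := D.exists_sqrtOp_wp_ne_zero q
  rw [residualNorms_eq h F D.wp_const D.wp_nonneg] at hb
  rw [rhoH, residualNorms_eq h F D.wp_const D.wp_nonneg]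
  exact norm_le_sSup_normalizedNorms (X := M.PwPoly q) D.k_pos hb
    (fun θ hθ => eq_zero_of_bddAbove_normalizedNorms D.k_pos hb (y := η) hη hθ) θ

theorem norm_sqrtOp_proj_le {w : RVec n → ℝ} (hw : M.IsPwConst w)
    (h0 : ∀ K ∈ M.elems, ∀ x ∈ elem K, 0 ≤ w x) (u : L2 G.Ω) :
    ‖sqrtOp hw (M.proj q u : L2 G.Ω)‖ ≤ ‖sqrtOp hw u‖ := by
  have h := norm_sqrtOp_sq_eq_add hw h0 (zero_mem (M.PwPoly q)) u
  rw [sub_zero, sub_zero] at h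
  refine (sq_le_sq₀ (norm_nonneg _) (norm_nonneg _)).1 ?_
  rw [h]
  exact le_add_of_nonneg_left (sq_nonneg _)

theorem norm_sqrtOp_mono {w w' : RVec n → ℝ} (hw : M.IsPwConst w) (hw' : M.IsPwConst w')
    (hle : ∀ K ∈ M.elems, ∀ x ∈ elem K, w x ≤ w' x) (u : L2 G.Ω) :
    ‖sqrtOp hw u‖ ≤ ‖sqrtOp hw' u‖ := by
  refine Lp.norm_le_norm_of_ae_le ?_
  filter_upwards [scalarOp_ae (hw.comp Real.sqrt) u, scalarOp_ae (hw'.comp Real.sqrt) u,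
    M.ae_of_forall_elem hle] with x h1 h2 h3
  rw [sqrtOp, sqrtOp, h1, h2, norm_mul, norm_mul, Complex.norm_real, Complex.norm_real,
    Real.norm_of_nonneg (Real.sqrt_nonneg _), Real.norm_of_nonneg (Real.sqrt_nonneg _)]
  gcongr

/-- The correction of the test function thus recovers precisely the part of `‖u‖_𝔭²` that `Q_h`
resolves. -/
theorem inner_scalarOp_proj (u : L2 G.Ω) :
    (inner ℂ (scalarOp D.wp_const (M.proj q u : L2 G.Ω)) u).re =
      ‖sqrtOp D.wp_const (M.proj q u : L2 G.Ω)‖ ^ 2 := by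
  have h := inner_sqrtOp_sub_proj D.wp_const D.wp_nonneg (M.proj q u).2 u
  rw [map_sub, inner_sub_right, sub_eq_zero] at h
  rw [← inner_sqrtOp D.wp_const D.wp_nonneg, h]
  exact inner_self_eq_norm_sq (𝕜 := ℂ) _

theorem re_beta_add_two_smul_sol (h : D.DiscreteWellPosed r q)
    {F : M.PwPoly q →ₗ[ℂ] HdivZero G.Ω G.ΓD} (hF : D.IsFluxReconstruction h F) (θ : M.PwPoly q)
    {u : L2 G.Ω × L2v G.Ω} (hu : u ∈ H1zero G.Ω G.ΓD) :
    (D.beta u (u + (2 : ℂ) • (h.sol θ).1)).re = (D.beta u u).re +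
      2 * (D.k ^ 2 * (inner ℂ (scalarOp D.wp_const (θ : L2 G.Ω)) u.1).re +
        (inner ℂ (residualLin h F θ) u.2).re) := by
  have key : ∀ a b c : ℂ, (a + conj (2 : ℂ) * ((D.k : ℂ) ^ 2 * b + c)).re =
      a.re + 2 * (D.k ^ 2 * b.re + c.re) := fun a b c => by
    rw [Complex.conj_ofNat, Complex.add_re, ← Complex.ofReal_pow, ← Complex.ofReal_ofNat,
      Complex.re_ofReal_mul, Complex.add_re, Complex.re_ofReal_mul]
  rw [beta_add_right, beta_smul_right, beta_sol h hF θ hu, key]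

/-- To be read with `E = |||u|||`, `m = ‖u‖_𝔪`, `B = ‖∇u‖_𝔄`, `b = Re β(u,u)`; `P`, `Q`, `T` the
`𝔭`-norms of `u`, `u - π_h u`, `π_h u`; `i` the real part of the residual paired with `∇u`, `R` the
residual norm, and `s` the norm of `π_h u` in the normalizing weight. -/
theorem le_of_estimates {k η ρ E b i P Q T B R s m : ℝ} (hk : 0 ≤ k) (hρ : 0 ≤ ρ) (hQ : 0 ≤ Q)
    (hB : 0 ≤ B) (hE : E ^ 2 = k ^ 2 * m ^ 2 + B ^ 2)
    (hg : E ^ 2 - 2 * k ^ 2 * P ^ 2 ≤ b) (hpyth : P ^ 2 = Q ^ 2 + T ^ 2) (hQB : Q ≤ η * B)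
    (hi : -i ≤ R * B) (hR : R ≤ ρ * (k * s)) (hs : s ≤ m) :
    (1 - 2 * (k * η) ^ 2 - 2 * ρ) * E ^ 2 ≤ b + 2 * (k ^ 2 * T ^ 2 + i) := by
  have h1 : k ^ 2 * Q ^ 2 ≤ (k * η) ^ 2 * E ^ 2 := by
    calc _ ≤ k ^ 2 * (η * B) ^ 2 := by gcongr
      _ = (k * η) ^ 2 * B ^ 2 := by ring
      _ ≤ _ := by
        refine mul_le_mul_of_nonneg_left ?_ (sq_nonneg _)
        rw [hE]
        exact le_add_of_nonneg_left (by positivity)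
  have h2 : -i ≤ ρ * E ^ 2 := by
    calc _ ≤ _ := hi
      _ ≤ (ρ * (k * m)) * B := by
        gcongr
        exact hR.trans (by gcongr)
      _ = ρ * ((k * m) * B) := by ring
      _ ≤ _ := by
        gcongr
        rw [hE]
        nlinarith [sq_nonneg (k * m - B), sq_nonneg (k * m), sq_nonneg B]
  -- The factor 2 on the correction matches that of the Gårding inequality: the terms `2k²T²` cancel
  -- and `2k²Q²` remains.
  rw [hpyth] at hg
  linarith

/-- Lower bound of the form, for any bound of the residual by a weighted norm of the datum. -/
theorem le_re_beta (hn : 0 < n) (hn3 : n ≤ 3) (hG : D.Garding) (h : D.DiscreteWellPosed r q)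
    {F : M.PwPoly q →ₗ[ℂ] HdivZero G.Ω G.ΓD} (hF : D.IsFluxReconstruction h F)
    {η : ℝ} (hη : 0 ≤ η) (hmax : ∀ K ∈ M.elems, elemDiam K * D.invSpeed K ≤ η)
    {w : RVec n → ℝ} (hw : M.IsPwConst w) (hw0 : ∀ K ∈ M.elems, ∀ x ∈ elem K, 0 ≤ w x)
    (hwm : ∀ K ∈ M.elems, ∀ x ∈ elem K, w x ≤ D.wm x) {ρ : ℝ} (hρ : 0 ≤ ρ)
    (hR : ∀ θ : M.PwPoly q, ‖rootOp (D.wA_const.comp (·⁻¹)) (residualLin h F θ)‖ ≤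
      ρ * (D.k * ‖sqrtOp hw (θ : L2 G.Ω)‖))
    {u : L2 G.Ω × L2v G.Ω} (hu : u ∈ H1zero G.Ω G.ΓD) :
    (1 - 2 * (D.k * η) ^ 2 - 2 * ρ) * D.energy u ^ 2 ≤
      (D.beta u (u + (2 : ℂ) • (h.sol (M.proj q u.1)).1)).re := by
  have e := re_beta_add_two_smul_sol h hF (M.proj q u.1) hu
  have hg := hG u hu
  rw [wnorm_eq_norm D.wp_const D.wp_nonneg] at hg
  have hpyth := norm_sqrtOp_sq_eq_add D.wp_const D.wp_nonneg (zero_mem (M.PwPoly q)) u.1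
  rw [sub_zero, sub_zero] at hpyth
  rw [inner_scalarOp_proj] at e
  refine le_of_le_of_eq (le_of_estimates D.k_pos.le hρ (norm_nonneg _) (norm_nonneg _)
    (D.energy_sq u) hg hpyth (D.norm_sqrtOp_sub_proj_le hn hn3 hη hmax q hu) ?_
    (hR (M.proj q u.1)) ?_) e.symm
  · exact ((neg_le_abs _).trans (Complex.abs_re_le_norm _)).trans
      (norm_inner_le_rootOp D.wA_const D.wA_posDef _ _)
  · exact (norm_sqrtOp_proj_le hw hw0 u.1).trans (norm_sqrtOp_mono hw D.wm_const hwm u.1)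

/-- From the lower bound of the form to the inf-sup constant. -/
theorem le_infSup (hn : 0 < n) (h : D.DiscreteWellPosed r q) {c : ℝ}
    (hc : ∀ u ∈ H1zero G.Ω G.ΓD, c * D.energy u ^ 2 ≤
      (D.beta u (u + (2 : ℂ) • (h.sol (M.proj q u.1)).1)).re) :
    ((c / (1 + 2 * D.thetaH h) : ℝ) : EReal) ≤ D.infSup := by
  have hΘ := thetaH_nonneg h
  refine le_iInf₂ fun u hu => ?_
  obtain ⟨huH, hu1⟩ := hu
  have hle : ∀ v ∈ H1zero G.Ω G.ΓD, D.energy v = 1 → c / (1 + 2 * D.thetaH h) ≤ (D.beta u v).re →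
      ((c / (1 + 2 * D.thetaH h) : ℝ) : EReal) ≤
        ⨆ v ∈ {v | v ∈ H1zero G.Ω G.ΓD ∧ D.energy v = 1}, (((D.beta u v).re : ℝ) : EReal) :=
    fun v hv hv1 hb => (EReal.coe_le_coe_iff.2 hb).trans
      (le_iSup₂ (f := fun v _ => (((D.beta u v).re : ℝ) : EReal)) v ⟨hv, hv1⟩)
  -- For `c ≤ 0` the bound is nonpositive, and one of `v = u`, `v = -u` makes `Re β(u, v)`
  -- nonnegative.
  rcases le_or_gt c 0 with hneg | hpos
  · have hγ : c / (1 + 2 * D.thetaH h) ≤ 0 := div_nonpos_of_nonpos_of_nonneg hneg (by linarith)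
    rcases le_total 0 (D.beta u u).re with hb | hb
    · exact hle u huH hu1 (hγ.trans hb)
    · refine hle ((-1 : ℂ) • u) (Submodule.smul_mem _ _ huH) (by rw [energy_smul, hu1]; simp) ?_
      rw [beta_smul_right]
      simp only [map_neg, map_one, neg_mul, one_mul, Complex.neg_re]
      linarith
  · have hb := hc u huH
    rw [hu1, one_pow, mul_one] at hb
    set v := u + (2 : ℂ) • (h.sol (M.proj q u.1)).1 with hv
    have hvH : v ∈ H1zero G.Ω G.ΓD :=
      Submodule.add_mem _ huH (Submodule.smul_mem _ _ (h.sol (M.proj q u.1)).2.1)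
    -- Zero energy would give `v = 0`, hence `β(u, v) = 0`, against the positive lower bound `c`.
    have hv0 : D.energy v ≠ 0 := fun h0 => by
      have e : v = (0 : ℂ) • u := by rw [D.eq_zero_of_energy_eq_zero hn h0, zero_smul]
      rw [e, beta_smul_right, map_zero, zero_mul, Complex.zero_re] at hb
      linarith
    have hvpos : 0 < D.energy v := lt_of_le_of_ne (D.energy_nonneg v) hv0.symm
    have hvle : D.energy v ≤ 1 + 2 * D.thetaH h := by
      refine (D.energy_add_le _ _).trans ?_
      rw [hu1, energy_smul, Complex.norm_ofNat]
      have h1 := energy_sol_le h (M.proj q u.1)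
      -- The projection contracts the `𝔪`-norm, and `k‖u‖_𝔪 ≤ |||u||| = 1`.
      have h2 : D.k * ‖sqrtOp D.wm_const (M.proj q u.1 : L2 G.Ω)‖ ≤ 1 := by
        have h3 := norm_sqrtOp_proj_le (q := q) D.wm_const D.wm_nonneg u.1
        have h4 := D.energy_sq u
        rw [hu1] at h4
        have h5 : D.k * ‖sqrtOp D.wm_const u.1‖ ≤ 1 := by
          have h6 : (D.k * ‖sqrtOp D.wm_const u.1‖) ^ 2 ≤ 1 ^ 2 := by
            rw [mul_pow]
            linarith [sq_nonneg ‖rootOp D.wA_const u.2‖]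
          exact (sq_le_sq₀ (mul_nonneg D.k_pos.le (norm_nonneg _)) zero_le_one).1 h6
        exact (mul_le_mul_of_nonneg_left h3 D.k_pos.le).trans h5
      have h7 := h1.trans (mul_le_of_le_one_right hΘ h2)
      linarith
    refine hle ((((D.energy v)⁻¹ : ℝ) : ℂ) • v) (Submodule.smul_mem _ _ hvH) ?_ ?_
    · rw [energy_smul, Complex.norm_real, Real.norm_of_nonneg (inv_nonneg.2 hvpos.le),
        inv_mul_cancel₀ hv0]
    · rw [beta_smul_right, Complex.conj_ofReal, Complex.re_ofReal_mul, inv_mul_eq_div]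
      exact div_le_div₀ (hpos.le.trans hb) hb hvpos hvle

end Coeffs

end InfSup

end

open InfSup in
theorem mainTheorem1 {n : ℕ} (hn : n = 2 ∨ n = 3) {G : Domain n} {M : Mesh G} (D : Coeffs M)
    (hG : D.Garding) (r q : ℕ) (hr : 1 ≤ r) (hP : D.DiscreteWellPosed r q)
    (F : M.PwPoly q →ₗ[ℂ] HdivZero G.Ω G.ΓD) (hF : D.IsFluxReconstruction hP F)
    (Kstar : Finset (RVec n)) (hK : Kstar ∈ M.elems)
    (hmax : ∀ K ∈ M.elems, elemDiam K * D.invSpeed K ≤ elemDiam Kstar * D.invSpeed Kstar) :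
    ((∀ u ∈ H1zero G.Ω G.ΓD,
        (1 - 2 * (D.k * (elemDiam Kstar * D.invSpeed Kstar)) ^ 2 - 2 * D.rhoH hP F D.wm)
            * D.energy u ^ 2
          ≤ (D.beta u (u + (2 : ℂ) • (hP.sol (M.proj q u.1)).1)).re) ∧
      (((1 - 2 * (D.k * (elemDiam Kstar * D.invSpeed Kstar)) ^ 2 - 2 * D.rhoH hP F D.wm)
          / (1 + 2 * D.thetaH hP) : ℝ) : EReal) ≤ D.infSup) ∧
    ((∀ K ∈ M.elems, ∀ x ∈ elem K, D.wp x ≤ D.wm x) → BddAbove (D.residualNorms hP F D.wp) →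
      (∀ u ∈ H1zero G.Ω G.ΓD,
        (1 - 2 * (D.k * (elemDiam Kstar * D.invSpeed Kstar)) ^ 2 - 2 * D.rhoH hP F D.wp)
            * D.energy u ^ 2
          ≤ (D.beta u (u + (2 : ℂ) • (hP.sol (M.proj q u.1)).1)).re) ∧
      (((1 - 2 * (D.k * (elemDiam Kstar * D.invSpeed Kstar)) ^ 2 - 2 * D.rhoH hP F D.wp)
          / (1 + 2 * D.thetaH hP) : ℝ) : EReal) ≤ D.infSup) := by
  have hn0 : 0 < n := by omega
  have hn3 : n ≤ 3 := by omega
  have hη : 0 ≤ elemDiam Kstar * D.invSpeed Kstar :=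
    mul_nonneg Metric.diam_nonneg (Real.sqrt_nonneg _)
  -- The same estimate serves both claims: the normalizing weight is `𝔪` here and `𝔭` below, where
  -- `𝔭 ≤ 𝔪` still allows `k‖π_h u‖_𝔭` to be bounded by `k‖u‖_𝔪`.
  have hm := fun u (hu : u ∈ H1zero G.Ω G.ΓD) =>
    Coeffs.le_re_beta hn0 hn3 hG hP hF hη hmax D.wm_const D.wm_nonneg (fun _ _ _ _ => le_rfl)
      (Coeffs.rhoH_nonneg hP F D.wm) (Coeffs.residual_le_wm hP F) hu
  refine ⟨⟨hm, Coeffs.le_infSup hn0 hP hm⟩, fun hpm hb => ?_⟩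
  have hp := fun u (hu : u ∈ H1zero G.Ω G.ΓD) =>
    Coeffs.le_re_beta hn0 hn3 hG hP hF hη hmax D.wp_const D.wp_nonneg hpm
      (Coeffs.rhoH_nonneg hP F D.wp) (Coeffs.residual_le_wp hP F hb) hu
  exact ⟨hp, Coeffs.le_infSup hn0 hP hp⟩
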